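/- All graphs are finite and simple. For a connected graph $G$ and $S\subseteq V(G)$, the Steiner distance $d_G(S)$ is the minimum number of edges of a connected subgraph of $G$ whose vertex set contains $S$, and $SW_k(G)=\sum_{S\subseteq V(G),\,|S|=k} d_G(S)$. A block of $G$ is a maximal connected induced subgraph without cut vertices of its own; $G$ is a block graph if every block is a clique. A block graph is star-like if it has a vertex adjacent to all other vertices, and path-like if it is isomorphic to the line graph of a caterpillar (a tree from which a path remains after deleting all leaves). Let $t\ge 1$, let $b_1\ge b_2\ge\dots\ge b_t\ge 2$ be integers, and let $\mathcal G(b_1,\dots,b_t)$ be the class of all connected block graphs with exactly $t$ blocks, of orders $b_1,\dots,b_t$. Put $n=1+\sum_{i=1}^t(b_i-1)$ and let $2\le k\le n$. Then every graph in $\mathcal G(b_1,\dots,b_t)$ has $n$ vertices, and: 1. every $G\in\mathcal G(b_1,\dots,b_t)$ satisfies $$SW_k(G)\ \ge\ (n-1)\binom{n-1}{k-1}-\sum_{i=1}^t\binom{b_i-1}{k},$$ and equality holds whenever $G$ is star-like; moreover $\mathcal G(b_1,\dots,b_t)$ contains a star-like block graph, so this value is the minimum of $SW_k$ over $\mathcal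 G(b_1,\dots,b_t)$; 2. the maximum of $SW_k$ over $\mathcal G(b_1,\dots,b_t)$ is attained by a path-like block graph: there is a path-like $G_1\in\mathcal G(b_1,\dots,b_t)$ with $SW_k(G)\le SW_k(G_1)$ for all $G\in\mathcal G(b_1,\dots,b_t)$. -/

import Mathlib

universe u

namespace SimpleGraph

variable {V : Type*}

/-- The Steiner distance of `S`: the minimum number of edges of a connected subgraph of `G`
whose vertex set contains `S`. (The set of candidates is nonempty when `G` is connected.) -/
noncomputable def steinerDist (G : SimpleGraph V) (S : Set V) : ℕ :=
  sInf {m | ∃ H : G.Subgraph, H.Connected ∧ S ⊆ H.verts ∧ H.edgeSet.ncard = m}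

/-- The Steiner `k`-Wiener index: the sum of the Steiner distances of all `k`-sets of vertices. -/
noncomputable def steinerWiener [Fintype V] (k : ℕ) (G : SimpleGraph V) : ℕ :=
  ∑ S ∈ (Finset.univ : Finset V).powersetCard k, G.steinerDist (S : Set V)

/-- `v` is a cut vertex of the (finite) graph `G`: deleting `v` increases the number of
connected components. -/
def IsCutVertex (G : SimpleGraph V) (v : V) : Prop :=
  Nat.card G.ConnectedComponent < Nat.card (G.induce ({v}ᶜ : Set V)).ConnectedComponent

/-- `B` is the vertex set of a block of `G`: a maximal connected induced subgraph
that has no cut vertex of its own. -/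
def IsBlock (G : SimpleGraph V) (B : Set V) : Prop :=
  Maximal (fun S : Set V => (G.induce S).Connected ∧ ∀ v : S, ¬ (G.induce S).IsCutVertex v) B

/-- A block graph: every block is a clique. -/
def IsBlockGraph (G : SimpleGraph V) : Prop :=
  ∀ B : Set V, G.IsBlock B → G.IsClique B

/-- The block order sequence of `G` is `b 0 ≥ b 1 ≥ ⋯ ≥ b (t - 1)`: the blocks of `G` can be
listed without repetition as `B 0, …, B (t - 1)` with `B i` of order `b i`. -/
def HasBlockOrderSequence {t : ℕ} (G : SimpleGraph V) (b : Fin t → ℕ) : Prop :=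
  Antitone b ∧ ∃ B : Fin t ≃ {B : Set V // G.IsBlock B}, ∀ i, (B i : Set V).ncard = b i

/-- Membership in the class of connected block graphs with block order sequence `b`. -/
structure InBlockClass {t : ℕ} (b : Fin t → ℕ) (G : SimpleGraph V) : Prop where
  connected : G.Connected
  isBlockGraph : G.IsBlockGraph
  hasBlockOrderSequence : G.HasBlockOrderSequence b

/-- A star-like block graph: a block graph with a universal vertex. -/
def IsStarLike (G : SimpleGraph V) : Prop :=
  G.IsBlockGraph ∧ ∃ v, G.IsUniversal v

/-- A caterpillar: a tree from which a path remains when all leaves (vertices with exactly one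
neighbour) are deleted. The path may consist of one vertex (stars); it is empty only for the
tree on two vertices. -/
def IsCaterpillar (T : SimpleGraph V) : Prop :=
  T.IsTree ∧ ∃ m : ℕ, Nonempty (T.induce {v | ¬ ∃! w, T.Adj v w} ≃g pathGraph m)

/-- A path-like block graph: the line graph of a (finite) caterpillar. -/
def IsPathLike (G : SimpleGraph V) : Prop :=
  ∃ (m : ℕ) (T : SimpleGraph (Fin m)), T.IsCaterpillar ∧ Nonempty (G ≃g T.lineGraph)

end SimpleGraph

/-! In a block graph every vertex w reaches a block B_i through one vertex of B_i, its gate. The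
gate map projects the graph to B_i, and an edge survives only the projection to its own block. So a
connected subgraph containing S needs at least |gate_i(S)| - 1 edges in each B_i, and the hull of S
attains this: d(S) = ∑_i (|gate_i(S)| - 1) (`steinerDist_eq`). Call the set of vertices with gate v
the fiber of v. Counting the k-sets that miss a fiber gives SW_k + ∑_i M_i = (n-1) C(n,k), where M_i
= ∑_{v ∈ B_i} C(n - |fiber of v|, k) (`steinerWiener_add_sum_missCount`). Only fiber sizes matter
from here on, and x ↦ C(x,k) is convex.

Minimum: for fixed b_i, convexity makes M_i largest when all fibers but one are singletons
(`missCount_le`). A universal vertex forces this in all blocks at once.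

Maximum: M_i falls when its fibers become more balanced. If a vertex lies in three blocks, or a
block has three cut vertices, then some block with all that hangs on it can be reattached so that no
SW_k decreases and SW_2 strictly increases. Strictness may fail for larger k, so a maximizer of
(SW_k, SW_2) in lexicographic order is taken. It has neither configuration, so its blocks form a
path. Adding a pendant end for every vertex that lies in one block only gives a caterpillar whose
line graph is the maximizer. -/

namespace SimpleGraph

/-! ### Projections to the blocks -/

/-- The graph in which two distinct vertices are adjacent when some member of the family `B`
contains both. -/
def cliqueUnion {V ι : Type*} (B : ι → Finset V) : SimpleGraph V where
  Adj u v := u ≠ v ∧ ∃ i, u ∈ B i ∧ v ∈ B i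
  symm := ⟨fun _ _ ⟨h, i, hu, hv⟩ => ⟨h.symm, i, hv, hu⟩⟩
  loopless := ⟨fun _ h => h.1 rfl⟩

/-- A connected family of cliques arranged in a tree-like manner, together with the gates:
`gate i w` is the vertex of `block i` through which `w` reaches `block i`. -/
structure GateSystem (V ι : Type*) where
  block : ι → Finset V
  gate : ι → V → V
  gate_mem : ∀ i w, gate i w ∈ block i
  gate_of_mem : ∀ {i w}, w ∈ block i → gate i w = w
  gate_const : ∀ {i j}, i ≠ j → ∀ {u v}, u ∈ block j → v ∈ block j → gate i u = gate i v
  connected : (cliqueUnion block).Connected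

namespace GateSystem

variable {V ι : Type*} (X : GateSystem V ι)

/-- The underlying graph of a gate system. -/
abbrev graph : SimpleGraph V := cliqueUnion X.block

theorem mem_of_adj_of_gate_ne {i : ι} {u v : V} (h : X.graph.Adj u v)
    (hne : X.gate i u ≠ X.gate i v) : u ∈ X.block i ∧ v ∈ X.block i := by
  obtain ⟨-, j, hu, hv⟩ := h
  rcases eq_or_ne i j with rfl | hij
  · exact ⟨hu, hv⟩
  · exact absurd (X.gate_const hij hu hv) hne

/-- Only edges inside `block i` change the gate, and a vertex of `block i` is its own gate; so the
first change along the walk starts at the gate of `w`. -/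
theorem gate_left_mem_support {i : ι} {w u : V} (p : X.graph.Walk w u)
    (hne : X.gate i w ≠ X.gate i u) : X.gate i w ∈ p.support := by
  induction p with
  | nil => exact absurd rfl hne
  | @cons w w' u h q ih =>
    by_cases hw : X.gate i w = X.gate i w'
    · rw [hw] at hne ⊢
      exact List.mem_cons_of_mem _ (ih hne)
    · rw [X.gate_of_mem (X.mem_of_adj_of_gate_ne h hw).1]
      simp

theorem gate_right_mem_support {i : ι} {w u : V} (p : X.graph.Walk w u)
    (hne : X.gate i w ≠ X.gate i u) : X.gate i u ∈ p.support := by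
  have := X.gate_left_mem_support p.reverse hne.symm
  simpa using this

/-- Take the block of the first edge of a path from `s` to `r`. If `r` reached it through `s`, the
rest of the path would return to `s`. -/
theorem exists_block_toward {s r : V} (h : s ≠ r) : ∃ i, s ∈ X.block i ∧ X.gate i r ≠ s := by
  classical
  obtain ⟨p, hp⟩ := (X.connected.preconnected s r).exists_isPath
  cases p with
  | nil => exact absurd rfl h
  | @cons _ s' _ hadj q =>
    rw [Walk.cons_isPath_iff] at hp
    obtain ⟨hne, i, hs, hs'⟩ := hadj
    refine ⟨i, hs, fun hg => hp.2 ?_⟩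
    have := X.gate_right_mem_support (i := i) q (by
      rw [X.gate_of_mem hs', hg]
      exact hne.symm)
    rwa [hg] at this

/-- One step towards `r` changes only the projection to the block of that step, where it becomes the
projection of `r`. -/
theorem gate_gate_eq_or {m : ι} {u : V} (hu : u ∈ X.block m) (r : V) (l : ι) :
    X.gate l (X.gate m r) = X.gate l u ∨ X.gate l (X.gate m r) = X.gate l r := by
  rcases eq_or_ne l m with rfl | hlm
  · exact .inr (X.gate_of_mem (X.gate_mem _ _))
  · exact .inl (X.gate_const hlm (X.gate_mem _ _) hu)

/-- Induction along the path from a vertex towards the root `r`. -/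
theorem gate_induction [Finite ι] {P : V → Prop} (r : V) (base : P r)
    (step : ∀ u m, u ∈ X.block m → X.gate m r ≠ u → P (X.gate m r) → P u) (u : V) : P u := by
  classical
  have := Fintype.ofFinite ι
  -- The number of blocks separating `u` from `r` drops with each step.
  generalize hc : (Finset.univ.filter fun i => X.gate i u ≠ X.gate i r).card = c
  induction c using Nat.strong_induction_on generalizing u with
  | _ c ih =>
    by_cases hur : u = r
    · rwa [hur]
    obtain ⟨m, hu, hm⟩ := X.exists_block_toward hur
    refine step u m hu hm (ih _ ?_ _ rfl)
    rw [← hc]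
    apply Finset.card_lt_card
    rw [Finset.ssubset_iff_of_subset]
    · refine ⟨m, ?_, ?_⟩
      · simp only [Finset.mem_filter, Finset.mem_univ, true_and]
        rw [X.gate_of_mem hu]
        exact hm.symm
      · simp [X.gate_of_mem (X.gate_mem m r)]
    · intro l
      simp only [Finset.mem_filter, Finset.mem_univ, true_and]
      intro hl
      rcases X.gate_gate_eq_or hu r l with h | h
      · rwa [h] at hl
      · exact absurd h hl

/-- The gate lies between `u` and `v`. Walking from `u` towards `v`, the gate in `block i` is
unchanged until a step inside `block i` is due, and that step starts at the gate. -/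
theorem gate_gate_of_gate_ne [Finite ι] {i : ι} {u v : V} (h : X.gate i u ≠ X.gate i v) (l : ι) :
    X.gate l (X.gate i u) = X.gate l u ∨ X.gate l (X.gate i u) = X.gate l v := by
  revert h
  refine X.gate_induction (P := fun u => X.gate i u ≠ X.gate i v →
    X.gate l (X.gate i u) = X.gate l u ∨ X.gate l (X.gate i u) = X.gate l v) v
    (fun h => absurd rfl h) ?_ u
  intro u m hu hm ih h
  rcases eq_or_ne i m with rfl | him
  · rw [X.gate_of_mem hu]
    exact .inl rfl
  · have e : X.gate i (X.gate m v) = X.gate i u := X.gate_const him (X.gate_mem _ _) hu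
    rw [e] at ih
    rcases ih h with h' | h'
    · rw [h']
      exact X.gate_gate_eq_or hu v l
    · exact .inr h'

/-- A block separating two vertices on one side of `block j` lies wholly on that side, because it
contains a vertex between the two. -/
theorem gate_eq_of_gate_ne [Finite ι] {i j : ι} {u v x : V} (hj : X.gate j u = X.gate j v)
    (hi : X.gate i u ≠ X.gate i v) (hx : x ∈ X.block i) : X.gate j x = X.gate j u := by
  have hij : j ≠ i := by
    rintro rfl
    exact hi hj
  rw [X.gate_const hij hx (X.gate_mem i u)]
  rcases X.gate_gate_of_gate_ne hi j with h | h
  · exact h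
  · rw [h, hj]

/-- Vertices that lie behind another vertex of `block j` than `block i` does reach `block i`
through the gate of `block i` in `block j`. -/
theorem gate_eq_gate [Finite ι] {i j : ι} (hij : i ≠ j) {x w a : V} (hx : x ∈ X.block i)
    (hxa : X.gate j x = a) (hw : X.gate j w ≠ a) : X.gate i w = X.gate i a := by
  have ha : a ∈ X.block j := hxa ▸ X.gate_mem _ _
  rw [← X.gate_const hij (X.gate_mem j w) ha]
  by_contra hne
  have := X.gate_eq_of_gate_ne (j := j) (u := w) (v := X.gate j w)
    (X.gate_of_mem (X.gate_mem j w)).symm hne hx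
  rw [hxa] at this
  exact hw this.symm

theorem gate_eq_self_of_gate_ne [Finite ι] {i j : ι} (hij : i ≠ j) {a w : V} (hi : a ∈ X.block i)
    (hj : a ∈ X.block j) (hw : X.gate j w ≠ a) : X.gate i w = a := by
  rw [X.gate_eq_gate hij hi (X.gate_of_mem hj) hw, X.gate_of_mem hi]

end GateSystem
end SimpleGraph

/-! ### Steiner distance and Steiner Wiener index in terms of gates -/

namespace SimpleGraph
namespace GateSystem

section Steiner

variable {V ι : Type*} (X : GateSystem V ι)

-- The image of `H` under the projection is connected, so it has at least one edge less than
-- vertices. An edge not collapsed lies in `block i`, is fixed by the projection, and so is an edge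
-- of `H`.
open scoped Classical in
theorem card_image_gate_le [Fintype V] (i : ι) (H : X.graph.Subgraph) (hH : H.Connected)
    (S : Finset V) (hS : (S : Set V) ⊆ H.verts) :
    (S.image (X.gate i)).card ≤
      (H.edgeSet.toFinset.filter fun e => ¬ (e.map (X.gate i)).IsDiag).card + 1 := by
  let Q : SimpleGraph (X.gate i '' H.verts) :=
    { Adj := fun x y => H.Adj x y ∧ X.gate i x ≠ X.gate i y
      symm := ⟨fun _ _ h => ⟨h.1.symm, h.2.symm⟩⟩
      loopless := ⟨fun _ h => h.2 rfl⟩ }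
  have hreach : ∀ (u v : H.verts), H.coe.Walk u v →
      Q.Reachable ⟨X.gate i u, Set.mem_image_of_mem _ u.2⟩
        ⟨X.gate i v, Set.mem_image_of_mem _ v.2⟩ := by
    intro u v p
    induction p with
    | nil => exact Reachable.refl _
    | @cons u w v h q ih =>
      refine Reachable.trans ?_ ih
      by_cases hg : X.gate i u = X.gate i w
      · simp only [hg]
        exact Reachable.refl _
      · have hm := X.mem_of_adj_of_gate_ne (H.adj_sub h) hg
        apply Adj.reachable
        refine ⟨?_, ?_⟩
        · have h' : H.Adj u w := h
          simpa only [X.gate_of_mem hm.1, X.gate_of_mem hm.2] using h'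
        · simpa only [X.gate_of_mem hm.1, X.gate_of_mem hm.2] using hg
  have hQ : Q.Connected := by
    have : Nonempty (X.gate i '' H.verts) := by
      obtain ⟨x⟩ := hH.coe.nonempty
      exact ⟨⟨_, Set.mem_image_of_mem _ x.2⟩⟩
    refine ⟨?_⟩
    rintro ⟨_, u, hu, rfl⟩ ⟨_, v, hv, rfl⟩
    obtain ⟨p⟩ := hH.coe.preconnected ⟨u, hu⟩ ⟨v, hv⟩
    exact hreach _ _ p
  have h1 := hQ.card_vert_le_card_edgeSet_add_one
  have h2 : (S.image (X.gate i)).card ≤ Nat.card (X.gate i '' H.verts) := by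
    rw [← Set.ncard_coe_finset, Nat.card_coe_set_eq, Finset.coe_image]
    exact Set.ncard_le_ncard (Set.image_mono hS)
  have h3 : Nat.card Q.edgeSet ≤
      (H.edgeSet.toFinset.filter fun e => ¬ (e.map (X.gate i)).IsDiag).card := by
    rw [← Set.ncard_coe_finset, Nat.card_coe_set_eq]
    refine Set.ncard_le_ncard_of_injOn (Sym2.map Subtype.val) ?_
      (Sym2.map.injective Subtype.val_injective).injOn
    intro e he
    induction e with
    | _ x y =>
      have he' : H.Adj x y ∧ X.gate i x ≠ X.gate i y := he
      simpa using he'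
  omega

-- Each edge survives at most one of the projections, so the edge sets counted for different blocks
-- are disjoint.
open scoped Classical in
theorem sum_card_image_gate_le [Fintype V] [Fintype ι] (H : X.graph.Subgraph) (hH : H.Connected)
    (S : Finset V) (hS : (S : Set V) ⊆ H.verts) :
    ∑ i, ((S.image (X.gate i)).card - 1) ≤ H.edgeSet.ncard := by
  calc ∑ i, ((S.image (X.gate i)).card - 1)
      ≤ ∑ i, (H.edgeSet.toFinset.filter fun e => ¬ (e.map (X.gate i)).IsDiag).card := by
        refine Finset.sum_le_sum fun i _ => ?_
        have := X.card_image_gate_le i H hH S hS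
        omega
    _ = (Finset.univ.biUnion fun i =>
          H.edgeSet.toFinset.filter fun e => ¬ (e.map (X.gate i)).IsDiag).card := by
        rw [Finset.card_biUnion]
        intro i _ j _ hij
        refine Finset.disjoint_left.2 ?_
        intro e hei hej
        induction e with
        | _ x y =>
          simp only [Finset.mem_filter, Set.mem_toFinset, Subgraph.mem_edgeSet, Sym2.map_mk,
            Sym2.mk_isDiag_iff] at hei hej
          have h := X.mem_of_adj_of_gate_ne (H.adj_sub hei.1) hei.2
          exact hej.2 (X.gate_const hij.symm h.1 h.2)
    _ ≤ H.edgeSet.toFinset.card :=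
        Finset.card_le_card (Finset.biUnion_subset.2 fun _ _ => Finset.filter_subset _ _)
    _ = H.edgeSet.ncard := by rw [Set.ncard_eq_toFinset_card']

/-- A connected set of vertices carries a connected subgraph with one edge less than vertices. -/
theorem _root_.SimpleGraph.exists_connected_subgraph_of_induce_connected {V : Type*} [Finite V]
    {G : SimpleGraph V} {W : Set V} (hW : (G.induce W).Connected) :
    ∃ H : G.Subgraph, H.Connected ∧ H.verts = W ∧ H.edgeSet.ncard + 1 = W.ncard := by
  obtain ⟨T, hT, htree⟩ := hW.exists_isTree_le
  let f : T →g G := (Embedding.induce W).toHom.comp (Hom.ofLE hT)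
  have hf : Function.Injective f := Subtype.val_injective
  refine ⟨(⊤ : T.Subgraph).map f, ?_, ?_, ?_⟩
  · let g : T →g ((⊤ : T.Subgraph).map f).coe :=
      { toFun := fun w => ⟨f w, w, trivial, rfl⟩
        map_rel' := fun {a b} h => ⟨a, b, h, rfl, rfl⟩ }
    refine ⟨htree.connected.map g ?_⟩
    rintro ⟨_, w, -, rfl⟩
    exact ⟨w, rfl⟩
  · ext v
    simp [f]
  · have h := (isTree_iff_connected_and_card.1 htree).2
    rw [Subgraph.edgeSet_map, Set.ncard_image_of_injective _ (Sym2.map.injective hf),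
      Subgraph.edgeSet_top]
    exact h

-- The filtered set is the hull of `S`. Each of its vertices other than `r` is charged to the block
-- of its first step towards `r`, where it is a projection of `S` different from the gate of `r`.
open scoped Classical in
theorem card_hull_le [Fintype V] [Fintype ι] (S : Finset V) {r : V} (hr : r ∈ S) :
    (Finset.univ.filter fun w => ∀ i, X.gate i w ∈ S.image (X.gate i)).card ≤
      ∑ i, ((S.image (X.gate i)).card - 1) + 1 := by
  set W := Finset.univ.filter fun w => ∀ i, X.gate i w ∈ S.image (X.gate i)
  have hsub : W ⊆ insert r
      (Finset.univ.biUnion fun i => (S.image (X.gate i)).erase (X.gate i r)) := by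
    intro w hw
    by_cases h : w = r
    · simp [h]
    · obtain ⟨j, hj, hne⟩ := X.exists_block_toward h
      refine Finset.mem_insert_of_mem (Finset.mem_biUnion.2 ⟨j, Finset.mem_univ _, ?_⟩)
      rw [Finset.mem_erase]
      refine ⟨hne.symm, ?_⟩
      have := (Finset.mem_filter.1 hw).2 j
      rwa [X.gate_of_mem hj] at this
  refine (Finset.card_le_card hsub).trans ((Finset.card_insert_le _ _).trans ?_)
  refine Nat.add_le_add_right (Finset.card_biUnion_le.trans (Finset.sum_le_sum fun i _ => ?_)) 1
  rw [Finset.card_erase_of_mem (Finset.mem_image_of_mem _ hr)]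

-- Each projection of the next vertex towards `r` is one of `u` or of `r`, so walking towards `r`
-- never leaves the hull.
open scoped Classical in
theorem induce_hull_connected [Finite ι] (S : Finset V) (hS : S.Nonempty) :
    (X.graph.induce {w | ∀ i, X.gate i w ∈ S.image (X.gate i)}).Connected := by
  obtain ⟨r, hr⟩ := hS
  set W : Set V := {w | ∀ i, X.gate i w ∈ S.image (X.gate i)}
  have hrW : r ∈ W := fun i => Finset.mem_image_of_mem _ hr
  have key : ∀ u, ∀ hu : u ∈ W, (X.graph.induce W).Reachable ⟨u, hu⟩ ⟨r, hrW⟩ := by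
    refine X.gate_induction r (fun _ => Reachable.refl _) ?_
    intro u m hum hm ih hu
    have hmem : X.gate m r ∈ W := by
      intro l
      rcases X.gate_gate_eq_or hum r l with h | h
      · exact h ▸ hu l
      · exact h ▸ hrW l
    refine Reachable.trans (Adj.reachable ?_) (ih hmem)
    exact ⟨hm.symm, m, hum, X.gate_mem _ _⟩
  have : Nonempty W := ⟨⟨r, hrW⟩⟩
  exact ⟨fun u v => (key u u.2).trans (key v v.2).symm⟩

open scoped Classical in
theorem steinerDist_eq [Fintype V] [Fintype ι] (S : Finset V) (hS : S.Nonempty) :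
    X.graph.steinerDist (S : Set V) = ∑ i, ((S.image (X.gate i)).card - 1) := by
  obtain ⟨H, hH, hv, he⟩ := exists_connected_subgraph_of_induce_connected
    (X.induce_hull_connected S hS)
  have hSH : (S : Set V) ⊆ H.verts := by
    rw [hv]
    exact fun s hs i => Finset.mem_image_of_mem _ hs
  rw [steinerDist]
  have hmem : H.edgeSet.ncard ∈ {m | ∃ H : X.graph.Subgraph,
      H.Connected ∧ (S : Set V) ⊆ H.verts ∧ H.edgeSet.ncard = m} := ⟨H, hH, hSH, rfl⟩
  apply le_antisymm
  · refine (Nat.sInf_le hmem).trans ?_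
    obtain ⟨r, hr⟩ := hS
    have h1 := X.card_hull_le S hr
    rw [← Set.ncard_coe_finset] at h1
    simp only [Finset.coe_filter, Finset.mem_univ, true_and] at h1
    omega
  · apply le_csInf ⟨_, hmem⟩
    rintro m ⟨H', hH', hS', rfl⟩
    exact X.sum_card_image_gate_le H' hH' S hS'

/-- Both bounds on the Steiner distance, applied to the set of all vertices. -/
theorem card_eq [Fintype V] [Fintype ι] : Fintype.card V = ∑ i, ((X.block i).card - 1) + 1 := by
  classical
  have himg : ∀ i, Finset.univ.image (X.gate i) = X.block i := by
    intro i
    ext v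
    simp only [Finset.mem_image, Finset.mem_univ, true_and]
    exact ⟨fun ⟨w, hw⟩ => hw ▸ X.gate_mem i w, fun h => ⟨v, X.gate_of_mem h⟩⟩
  obtain ⟨r⟩ := X.connected.nonempty
  have h1 := X.card_hull_le Finset.univ (Finset.mem_univ r)
  rw [Finset.filter_true_of_mem (fun w _ i => Finset.mem_image_of_mem _ (Finset.mem_univ w))] at h1
  obtain ⟨H, hH, hv, he⟩ := exists_connected_subgraph_of_induce_connected (W := Set.univ)
    ((induceUnivIso X.graph).connected_iff.2 X.connected)
  have h2 := X.sum_card_image_gate_le H hH Finset.univ (by simp [hv])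
  rw [Set.ncard_univ, Nat.card_eq_fintype_card] at he
  simp only [himg, Finset.card_univ] at h1 h2
  omega

open scoped Classical in
/-- The set of vertices that reach `block i` through `v`. -/
noncomputable def fiber [Fintype V] (i : ι) (v : V) : Finset V :=
  Finset.univ.filter fun w => X.gate i w = v

@[simp]
theorem mem_fiber [Fintype V] {i : ι} {v w : V} : w ∈ X.fiber i v ↔ X.gate i w = v := by
  simp [fiber]

/-- The number of `k`-subsets of vertices missing one of the fibers of `block i`, counted with
multiplicity. -/
noncomputable def missCount [Fintype V] (k : ℕ) (i : ι) : ℕ :=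
  ∑ v ∈ X.block i, (Fintype.card V - (X.fiber i v).card).choose k

-- Double counting of pairs (S, v): `v` is not a gate of S exactly when S avoids the fiber of `v`.
open scoped Classical in
theorem sum_card_image_gate_add_missCount [Fintype V] (k : ℕ) (i : ι) :
    ∑ S ∈ (Finset.univ : Finset V).powersetCard k, (S.image (X.gate i)).card + X.missCount k i =
      (X.block i).card * (Fintype.card V).choose k := by
  have h1 : ∀ S : Finset V, (S.image (X.gate i)).card =
      ∑ v ∈ X.block i, if v ∈ S.image (X.gate i) then 1 else 0 := by
    intro S
    rw [← Finset.card_filter]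
    congr 1
    ext v
    simp only [Finset.mem_image, Finset.mem_filter]
    exact ⟨fun ⟨w, hw, e⟩ => ⟨e ▸ X.gate_mem i w, w, hw, e⟩, fun h => h.2⟩
  simp_rw [h1]
  rw [Finset.sum_comm, missCount, ← Finset.sum_add_distrib]
  rw [Finset.sum_const_nat]
  intro v hv
  rw [← Finset.card_filter]
  have h2 : (Fintype.card V - (X.fiber i v).card).choose k =
      (((Finset.univ : Finset V).powersetCard k).filter
        fun S => ¬ v ∈ S.image (X.gate i)).card := by
    rw [← Finset.card_compl, ← Finset.card_powersetCard]
    congr 1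
    ext S
    simp only [Finset.mem_powersetCard, Finset.mem_filter,
      Finset.mem_image, not_exists, not_and, Finset.subset_iff, Finset.mem_compl, mem_fiber,
      Finset.mem_univ]
    tauto
  rw [h2, Finset.card_filter_add_card_filter_not, Finset.card_powersetCard, Finset.card_univ]

theorem steinerWiener_add_sum_missCount [Fintype V] [Fintype ι] {k : ℕ} (hk : 1 ≤ k) :
    X.graph.steinerWiener k + ∑ i, X.missCount k i =
      (Fintype.card V - 1) * (Fintype.card V).choose k := by
  classical
  have hne : ∀ S ∈ (Finset.univ : Finset V).powersetCard k, S.Nonempty := by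
    intro S hS
    rw [← Finset.card_pos, (Finset.mem_powersetCard.1 hS).2]
    exact hk
  have h1 : X.graph.steinerWiener k + Fintype.card ι * (Fintype.card V).choose k =
      ∑ i, ∑ S ∈ (Finset.univ : Finset V).powersetCard k, (S.image (X.gate i)).card := by
    rw [Finset.sum_comm, steinerWiener,
      Finset.sum_congr rfl fun S hS => X.steinerDist_eq S (hne S hS)]
    have : Fintype.card ι * (Fintype.card V).choose k =
        ∑ S ∈ (Finset.univ : Finset V).powersetCard k, ∑ i : ι, 1 := by
      simp [Finset.card_powersetCard, mul_comm]
    rw [this, ← Finset.sum_add_distrib]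
    refine Finset.sum_congr rfl fun S hS => ?_
    rw [← Finset.sum_add_distrib]
    refine Finset.sum_congr rfl fun i _ => ?_
    exact Nat.sub_add_cancel (Finset.card_pos.2 ((hne S hS).image _))
  have h2 := Finset.sum_congr (rfl : (Finset.univ : Finset ι) = Finset.univ)
    fun i _ => X.sum_card_image_gate_add_missCount k i
  rw [Finset.sum_add_distrib, ← h1, ← Finset.sum_mul] at h2
  obtain ⟨r⟩ := X.connected.nonempty
  have h3 : ∑ i, (X.block i).card = (Fintype.card V - 1) + Fintype.card ι := by
    rw [X.card_eq, Nat.add_sub_cancel]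
    have : Fintype.card ι = ∑ i : ι, 1 := by simp
    rw [this, ← Finset.sum_add_distrib]
    refine Finset.sum_congr rfl fun i _ => (Nat.sub_add_cancel ?_).symm
    exact Finset.card_pos.2 ⟨_, X.gate_mem i r⟩
  rw [h3, add_mul] at h2
  omega

end Steiner

end GateSystem
end SimpleGraph

/-! ### Convexity of binomial coefficients -/

theorem Nat.choose_add_choose_le_of_le {a b : ℕ} (h : a ≤ b) (c k : ℕ) :
    (a + c).choose k + b.choose k ≤ a.choose k + (b + c).choose k := by
  induction c with
  | zero => simp
  | succ c ih =>
    cases k with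
    | zero => simp
    | succ k =>
      rw [← add_assoc, ← add_assoc, Nat.choose_succ_succ (a + c) k, Nat.choose_succ_succ (b + c) k]
      have := Nat.choose_le_choose k (show a + c ≤ b + c by omega)
      simp only [Nat.succ_eq_add_one]
      omega

theorem Nat.choose_two_add_choose_two_lt {a b c : ℕ} (h : a < b) (hc : 0 < c) :
    (a + c).choose 2 + b.choose 2 < a.choose 2 + (b + c).choose 2 := by
  obtain ⟨c, rfl⟩ := Nat.exists_eq_succ_of_ne_zero hc.ne'
  have h1 := Nat.choose_add_choose_le_of_le h.le c 2
  rw [Nat.succ_eq_add_one, ← add_assoc, ← add_assoc, Nat.choose_succ_succ (a + c) 1,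
    Nat.choose_succ_succ (b + c) 1]
  simp only [Nat.succ_eq_add_one, Nat.choose_one_right]
  simp only [Nat.reduceAdd]
  omega

/-- By convexity, concentrating all deficits `m v` in a single term can only increase the sum. -/
theorem Finset.sum_choose_sub_le {α : Type*} (s : Finset α) (m : α → ℕ) (N k : ℕ)
    (h : ∑ v ∈ s, m v ≤ N) :
    ∑ v ∈ s, (N - m v).choose k + N.choose k ≤
      s.card * N.choose k + (N - ∑ v ∈ s, m v).choose k := by
  classical
  induction s using Finset.induction_on with
  | empty => simp
  | insert a s ha ih =>
    rw [Finset.sum_insert ha] at h ⊢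
    rw [Finset.sum_insert ha, Finset.card_insert_of_notMem ha]
    have h1 := ih (by omega)
    have h2 := Nat.choose_add_choose_le_of_le
      (show N - (m a + ∑ v ∈ s, m v) ≤ N - m a by omega) (m a) k
    rw [show N - (m a + ∑ v ∈ s, m v) + m a = N - ∑ v ∈ s, m v by omega,
      show N - m a + m a = N by omega] at h2
    rw [add_mul, one_mul]
    omega

/-! ### The lower bound and star-like graphs -/

namespace SimpleGraph
namespace GateSystem

variable {V ι : Type*} (X : GateSystem V ι)

theorem sum_card_fiber [Fintype V] (i : ι) :
    ∑ v ∈ X.block i, (X.fiber i v).card = Fintype.card V := by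
  classical
  rw [← Finset.card_univ, Finset.card_eq_sum_card_fiberwise (f := X.gate i) (t := X.block i)
    fun w _ => X.gate_mem i w]
  refine Finset.sum_congr rfl fun v _ => ?_
  congr 1

theorem card_fiber_pos [Fintype V] {i : ι} {v : V} (hv : v ∈ X.block i) :
    0 < (X.fiber i v).card :=
  Finset.card_pos.2 ⟨v, X.mem_fiber.2 (X.gate_of_mem hv)⟩

theorem missCount_le [Fintype V] (k : ℕ) (i : ι) :
    X.missCount k i ≤ ((X.block i).card - 1) * (Fintype.card V - 1).choose k +
      ((X.block i).card - 1).choose k := by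
  obtain ⟨r⟩ := X.connected.nonempty
  have hpos : 0 < (X.block i).card := Finset.card_pos.2 ⟨_, X.gate_mem i r⟩
  have hsum : ∑ v ∈ X.block i, ((X.fiber i v).card - 1) + (X.block i).card = Fintype.card V := by
    rw [← X.sum_card_fiber i, Finset.card_eq_sum_ones, ← Finset.sum_add_distrib]
    exact Finset.sum_congr rfl fun v hv => Nat.sub_add_cancel (X.card_fiber_pos hv)
  -- The deficits are the fiber sizes beyond 1. They add up to n minus the block order, which leaves
  -- the block order minus 1 for the concentrated term.
  have h := Finset.sum_choose_sub_le (X.block i) (fun v => (X.fiber i v).card - 1)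
    (Fintype.card V - 1) k (by omega)
  rw [show Fintype.card V - 1 - ∑ v ∈ X.block i, ((X.fiber i v).card - 1) =
    (X.block i).card - 1 by omega] at h
  have he : X.missCount k i =
      ∑ v ∈ X.block i, (Fintype.card V - 1 - ((X.fiber i v).card - 1)).choose k := by
    refine Finset.sum_congr rfl fun v hv => ?_
    have := X.card_fiber_pos hv
    congr 1
    omega
  rw [← he] at h
  obtain ⟨m, hm⟩ := Nat.exists_eq_succ_of_ne_zero hpos.ne'
  rw [hm, Nat.succ_eq_add_one, add_mul, one_mul] at h
  rw [hm, Nat.succ_eq_add_one, Nat.add_sub_cancel]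
  rw [Nat.add_sub_cancel] at h
  omega

/-- Sum `missCount_le` over the blocks, whose orders minus 1 add up to n - 1, and apply Pascal's
rule to C(n,k). -/
theorem le_steinerWiener [Fintype V] [Fintype ι] {k : ℕ} (hk : 1 ≤ k) :
    ((Fintype.card V : ℤ) - 1) * ((Fintype.card V - 1).choose (k - 1) : ℤ) -
        ∑ i, (((X.block i).card - 1).choose k : ℤ) ≤ (X.graph.steinerWiener k : ℤ) := by
  have h1 := X.steinerWiener_add_sum_missCount hk
  have h2 : ∑ i, X.missCount k i ≤ (Fintype.card V - 1) * (Fintype.card V - 1).choose k +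
      ∑ i, ((X.block i).card - 1).choose k := by
    have h3 : Fintype.card V - 1 = ∑ i, ((X.block i).card - 1) := by
      rw [X.card_eq, Nat.add_sub_cancel]
    calc ∑ i, X.missCount k i ≤ _ := Finset.sum_le_sum fun i _ => X.missCount_le k i
      _ = _ := by rw [Finset.sum_add_distrib, ← Finset.sum_mul, ← h3]
  obtain ⟨r⟩ := X.connected.nonempty
  obtain ⟨m, hm⟩ := Nat.exists_eq_succ_of_ne_zero (Fintype.card_pos_iff.2 ⟨r⟩).ne'
  obtain ⟨l, rfl⟩ := Nat.exists_eq_succ_of_ne_zero (show k ≠ 0 by omega)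
  rw [hm] at h1 h2 ⊢
  simp only [Nat.succ_eq_add_one, Nat.add_sub_cancel, Nat.choose_succ_succ m l, mul_add] at h1 h2 ⊢
  push_cast
  zify at h1 h2
  linarith

/-- The value of `missCount` when all fibers but one are trivial. -/
theorem missCount_eq_of_card_fiber_eq_one [Fintype V] (k : ℕ) {i : ι} {v : V}
    (hv : v ∈ X.block i) (h : ∀ u ∈ X.block i, u ≠ v → (X.fiber i u).card = 1) :
    X.missCount k i = ((X.block i).card - 1) * (Fintype.card V - 1).choose k +
      ((X.block i).card - 1).choose k := by
  classical
  have h1 : ∀ u ∈ (X.block i).erase v, (X.fiber i u).card = 1 := fun u hu =>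
    h u (Finset.mem_of_mem_erase hu) (Finset.ne_of_mem_erase hu)
  have hsum := X.sum_card_fiber i
  rw [← Finset.add_sum_erase _ _ hv, Finset.sum_congr rfl h1, ← Finset.card_eq_sum_ones,
    Finset.card_erase_of_mem hv] at hsum
  rw [missCount, ← Finset.add_sum_erase _ _ hv,
    Finset.sum_congr rfl fun u hu => by rw [h1 u hu], Finset.sum_const,
    Finset.card_erase_of_mem hv, smul_eq_mul, add_comm]
  congr 2
  omega

theorem steinerWiener_eq_of_isUniversal [Fintype V] [Fintype ι] {k : ℕ} (hk : 1 ≤ k)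
    (h2 : ∀ i, 2 ≤ (X.block i).card) {v : V} (hv : X.graph.IsUniversal v) :
    (X.graph.steinerWiener k : ℤ) =
      ((Fintype.card V : ℤ) - 1) * ((Fintype.card V - 1).choose (k - 1) : ℤ) -
        ∑ i, (((X.block i).card - 1).choose k : ℤ) := by
  -- If `v` were outside `block i`, its edge to a vertex `u` of `block i` other than its gate would
  -- lie in another block, giving both ends the gate `u`.
  have hmem : ∀ i, v ∈ X.block i := by
    intro i
    by_contra hvi
    obtain ⟨u, hu, hne⟩ := Finset.exists_mem_ne (h2 i) (X.gate i v)
    obtain ⟨-, j, hvj, huj⟩ := hv (w := u) (by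
      rintro rfl
      exact hvi hu)
    have hij : i ≠ j := by
      rintro rfl
      exact hvi hvj
    have := X.gate_const hij huj hvj
    rw [X.gate_of_mem hu] at this
    exact hne this
  have hone : ∀ i, ∀ u ∈ X.block i, u ≠ v → (X.fiber i u).card = 1 := by
    intro i u hu huv
    rw [Finset.card_eq_one]
    refine ⟨u, Finset.eq_singleton_iff_unique_mem.2 ⟨X.mem_fiber.2 (X.gate_of_mem hu), ?_⟩⟩
    intro w hw
    rw [mem_fiber] at hw
    have hwv : v ≠ w := by
      rintro rfl
      rw [X.gate_of_mem (hmem i)] at hw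
      exact huv hw.symm
    obtain ⟨-, j, hvj, hwj⟩ := hv hwv
    rcases eq_or_ne i j with rfl | hij
    · rwa [X.gate_of_mem hwj] at hw
    · rw [X.gate_const hij hwj hvj, X.gate_of_mem (hmem i)] at hw
      exact absurd hw.symm huv
  have h1 := X.steinerWiener_add_sum_missCount hk
  have h3 : Fintype.card V - 1 = ∑ i, ((X.block i).card - 1) := by
    rw [X.card_eq, Nat.add_sub_cancel]
  have h2 : ∑ i, X.missCount k i = (Fintype.card V - 1) * (Fintype.card V - 1).choose k +
      ∑ i, ((X.block i).card - 1).choose k := by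
    rw [Finset.sum_congr rfl fun i _ =>
      X.missCount_eq_of_card_fiber_eq_one k (hmem i) (hone i), Finset.sum_add_distrib,
      ← Finset.sum_mul, ← h3]
  obtain ⟨m, hm⟩ := Nat.exists_eq_succ_of_ne_zero (Fintype.card_pos_iff.2 ⟨v⟩).ne'
  obtain ⟨l, rfl⟩ := Nat.exists_eq_succ_of_ne_zero (show k ≠ 0 by omega)
  rw [hm] at h1 h2 ⊢
  simp only [Nat.succ_eq_add_one, Nat.add_sub_cancel, Nat.choose_succ_succ m l, mul_add] at h1 h2 ⊢
  push_cast
  zify at h1 h2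
  linarith

end GateSystem
end SimpleGraph

/-! ### Blocks as maximal nonseparable sets; from block graphs to gate systems -/

namespace SimpleGraph

section Nonseparable

variable {V : Type*} {G : SimpleGraph V}

/-- Any two vertices of `A` are joined by a walk of `G` inside `A`. -/
def IsLinked (G : SimpleGraph V) (A : Set V) : Prop :=
  ∀ u ∈ A, ∀ v ∈ A, ∃ p : G.Walk u v, ∀ x ∈ p.support, x ∈ A

theorem preconnected_induce_iff_isLinked {A : Set V} :
    (G.induce A).Preconnected ↔ G.IsLinked A := by
  constructor
  · have key : ∀ {a b : A}, (G.induce A).Walk a b →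
        ∃ p : G.Walk a b, ∀ x ∈ p.support, x ∈ A := by
      intro a b p
      induction p with
      | @nil a => exact ⟨.nil, by simp⟩
      | @cons a _ _ h _ ih =>
        obtain ⟨q, hq⟩ := ih
        refine ⟨.cons (induce_adj.1 h) q, fun x hx => ?_⟩
        rw [Walk.support_cons, List.mem_cons] at hx
        rcases hx with rfl | hx
        · exact a.2
        · exact hq x hx
    intro h u hu v hv
    obtain ⟨p⟩ := h ⟨u, hu⟩ ⟨v, hv⟩
    exact key p
  · rintro h ⟨u, hu⟩ ⟨v, hv⟩
    obtain ⟨p, hp⟩ := h u hu v hv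
    exact ⟨p.induce A hp⟩

theorem IsLinked.of_center {A : Set V} (c : V)
    (h : ∀ u ∈ A, ∃ p : G.Walk u c, ∀ x ∈ p.support, x ∈ A) : G.IsLinked A := by
  intro u hu v hv
  obtain ⟨p, hp⟩ := h u hu
  obtain ⟨q, hq⟩ := h v hv
  refine ⟨p.append q.reverse, fun x hx => ?_⟩
  rw [Walk.mem_support_append_iff] at hx
  rcases hx with hx | hx
  · exact hp x hx
  · exact hq x (by simpa using hx)

theorem exists_walk_mem_of_eq_or_adj {A : Set V} {u v : V} (hu : u ∈ A) (hv : v ∈ A)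
    (h : u ≠ v → G.Adj u v) : ∃ p : G.Walk u v, ∀ x ∈ p.support, x ∈ A := by
  by_cases huv : u = v
  · subst huv
    exact ⟨.nil, by simpa using hu⟩
  · exact ⟨(h huv).toWalk, by simp [hu, hv]⟩

theorem IsClique.isLinked {A : Set V} (h : G.IsClique A) : G.IsLinked A :=
  fun _ hu _ hv => exists_walk_mem_of_eq_or_adj hu hv fun hne => h hu hv hne

/-- A nonempty connected set of vertices whose induced subgraph has no cut vertex. -/
def IsNonseparable (G : SimpleGraph V) (S : Set V) : Prop :=
  S.Nonempty ∧ G.IsLinked S ∧ ∀ c ∈ S, G.IsLinked (S \ {c})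

theorem isCutVertex_iff [Finite V] (hG : G.Connected) (v : V) :
    G.IsCutVertex v ↔ ¬ (G.induce ({v}ᶜ : Set V)).Preconnected := by
  have : Nonempty V := hG.nonempty
  have h1 : Nat.card G.ConnectedComponent = 1 := by
    have := hG.preconnected.subsingleton_connectedComponent
    exact Nat.card_eq_one_iff_unique.2 ⟨this, inferInstance⟩
  rw [IsCutVertex, h1, Finite.one_lt_card_iff_nontrivial, ← not_subsingleton_iff_nontrivial]
  refine not_congr ⟨fun h x y => ?_, fun h => h.subsingleton_connectedComponent⟩
  exact ConnectedComponent.exact (Subsingleton.elim _ _)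

theorem isLinked_diff_iff {S : Set V} (v : S) :
    ((G.induce S).induce ({v}ᶜ : Set S)).Preconnected ↔ G.IsLinked (S \ {v.1}) := by
  rw [← preconnected_induce_iff_isLinked]
  let e : (G.induce S).induce ({v}ᶜ : Set S) ≃g G.induce (S \ {v.1}) :=
    { toFun := fun x => ⟨x.1.1, x.1.2, fun h => x.2 (Subtype.ext h)⟩
      invFun := fun x => ⟨⟨x.1, x.2.1⟩, fun h => x.2.2 (congrArg Subtype.val h)⟩
      left_inv := fun _ => rfl
      right_inv := fun _ => rfl
      map_rel_iff' := Iff.rfl }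
  exact e.preconnected_iff

theorem isBlock_iff [Finite V] {B : Set V} : G.IsBlock B ↔ Maximal G.IsNonseparable B := by
  have h : (fun S : Set V => (G.induce S).Connected ∧ ∀ v : S, ¬ (G.induce S).IsCutVertex v) =
      G.IsNonseparable := by
    funext S
    apply propext
    constructor
    · rintro ⟨hc, hv⟩
      refine ⟨Set.nonempty_coe_sort.1 hc.nonempty,
        preconnected_induce_iff_isLinked.1 hc.preconnected, fun c hcS => ?_⟩
      have := hv ⟨c, hcS⟩
      rwa [isCutVertex_iff hc, not_not, isLinked_diff_iff] at this
    · rintro ⟨hne, hl, hd⟩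
      have : Nonempty S := hne.to_subtype
      have hc : (G.induce S).Connected := ⟨preconnected_induce_iff_isLinked.2 hl⟩
      refine ⟨hc, fun v => ?_⟩
      rw [isCutVertex_iff hc, not_not, isLinked_diff_iff]
      exact hd v v.2
  rw [IsBlock, h]

theorem IsClique.isNonseparable {A : Set V} (h : G.IsClique A) (hA : A.Nonempty) :
    G.IsNonseparable A :=
  ⟨hA, h.isLinked, fun _ _ => (h.subset Set.sdiff_subset).isLinked⟩

/-- After deletion of any vertex, `u` or `v` remains and is adjacent to everything else. -/
theorem IsNonseparable.union_of_isClique {A B : Set V} (hA : G.IsClique A) (hB : G.IsClique B)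
    {u v : V} (huv : u ≠ v) (huA : u ∈ A) (hvA : v ∈ A) (huB : u ∈ B) (hvB : v ∈ B) :
    G.IsNonseparable (A ∪ B) := by
  have key : ∀ C ⊆ A ∪ B, ∀ c ∈ C, c ∈ A → c ∈ B → G.IsLinked C := by
    intro C hC c hcC hcA hcB
    refine IsLinked.of_center c fun w hw => exists_walk_mem_of_eq_or_adj hw hcC fun hne => ?_
    rcases hC hw with h | h
    · exact hA h hcA hne
    · exact hB h hcB hne
  refine ⟨⟨u, .inl huA⟩, key _ subset_rfl u (.inl huA) huA huB, fun c _ => ?_⟩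
  by_cases hc : u = c
  · exact key _ Set.sdiff_subset v ⟨.inl hvA, fun h => huv (hc.trans (Eq.symm h))⟩ hvA hvB
  · exact key _ Set.sdiff_subset u ⟨.inl huA, hc⟩ huA huB

/-- Adding to a clique a path between two of its vertices yields a nonseparable set. -/
theorem IsNonseparable.clique_union_path {B : Set V} (hB : G.IsClique B) {u v : V} (huv : u ≠ v)
    (hu : u ∈ B) (hv : v ∈ B) (p : G.Walk u v) (hp : p.IsPath) :
    G.IsNonseparable (B ∪ {x | x ∈ p.support}) := by
  classical
  refine ⟨⟨u, .inl hu⟩, ?_, ?_⟩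
  · refine IsLinked.of_center u ?_
    rintro w (hw | hw)
    · exact exists_walk_mem_of_eq_or_adj (.inl hw) (.inl hu) fun hne => hB hw hu hne
    · refine ⟨(p.takeUntil w hw).reverse, fun x hx => .inr ?_⟩
      rw [Walk.support_reverse, List.mem_reverse] at hx
      exact p.support_takeUntil_subset_support hw hx
  · intro c _
    obtain ⟨d, hdB, hdc⟩ : ∃ d ∈ B, d ≠ c := by
      by_cases hc : u = c
      · exact ⟨v, hv, fun h => huv (hc.trans h.symm)⟩
      · exact ⟨u, hu, hc⟩
    have toD : ∀ w ∈ B, w ≠ c →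
        ∃ q : G.Walk w d, ∀ x ∈ q.support, x ∈ (B ∪ {x | x ∈ p.support}) \ {c} := fun w hw hwc =>
      exists_walk_mem_of_eq_or_adj ⟨.inl hw, hwc⟩ ⟨.inl hdB, hdc⟩ fun hne => hB hw hdB hne
    refine IsLinked.of_center d ?_
    rintro w ⟨hw | hw, hwc⟩
    · exact toD w hw hwc
    have hcat : ∀ z ∈ B, ∀ q : G.Walk w z, (∀ x ∈ q.support, x ∈ p.support) → c ∉ q.support →
        ∃ q : G.Walk w d, ∀ x ∈ q.support, x ∈ (B ∪ {x | x ∈ p.support}) \ {c} := by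
      intro z hz q hq hcq
      obtain ⟨q', hq'⟩ := toD z hz (fun h => hcq (h ▸ q.end_mem_support))
      refine ⟨q.append q', fun x hx => ?_⟩
      rw [Walk.mem_support_append_iff] at hx
      rcases hx with hx | hx
      · exact ⟨.inr (hq x hx), fun h => hcq (Set.mem_singleton_iff.1 h ▸ hx)⟩
      · exact hq' x hx
    -- A path visits `c` at most once, so one of the two parts of `p` at `w` avoids `c` and leads to
    -- `B`.
    by_cases hct : c ∈ (p.takeUntil w hw).support
    · refine hcat v hv (p.dropUntil w hw) (fun x hx => p.support_dropUntil_subset_support hw hx) ?_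
      intro hcd
      have hnd := hp.support_nodup
      rw [← p.take_spec hw, Walk.support_append, List.nodup_append'] at hnd
      refine hnd.2.2 hct ?_
      rw [Walk.mem_support_iff] at hcd
      exact hcd.resolve_left fun h => hwc h.symm
    · refine hcat u hu (p.takeUntil w hw).reverse (fun x hx => ?_) (by simpa using hct)
      rw [Walk.support_reverse, List.mem_reverse] at hx
      exact p.support_takeUntil_subset_support hw hx

/-- The graph obtained from `G` by deleting all edges inside `B`. -/
def deleteInside (G : SimpleGraph V) (B : Set V) : SimpleGraph V where
  Adj u v := G.Adj u v ∧ ¬ (u ∈ B ∧ v ∈ B)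
  symm := ⟨fun _ _ h => ⟨h.1.symm, fun h' => h.2 h'.symm⟩⟩
  loopless := ⟨fun _ h => G.loopless.irrefl _ h.1⟩

theorem exists_reachable_deleteInside {B : Set V} {w b : V} (hb : b ∈ B) (p : G.Walk w b) :
    ∃ v ∈ B, (G.deleteInside B).Reachable w v := by
  induction p with
  | nil => exact ⟨_, hb, Reachable.refl _⟩
  | @cons w w' b h q ih =>
    by_cases hw : w ∈ B
    · exact ⟨w, hw, Reachable.refl _⟩
    · obtain ⟨v, hv, hr⟩ := ih hb
      have hadj : (G.deleteInside B).Adj w w' := ⟨h, fun h' => hw h'.1⟩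
      exact ⟨v, hv, hadj.reachable.trans hr⟩

/-- A path joining two vertices of `B` would, by maximality, stay in `B`; then its first edge would
be one of the deleted ones. -/
theorem eq_of_reachable_deleteInside {B : Set V} (hB : Maximal G.IsNonseparable B)
    (hcl : G.IsClique B) {u v : V} (hu : u ∈ B) (hv : v ∈ B)
    (h : (G.deleteInside B).Reachable u v) : u = v := by
  classical
  by_contra huv
  obtain ⟨p, hp⟩ := h.exists_isPath
  have hle : G.deleteInside B ≤ G := fun _ _ h => h.1
  have hns := IsNonseparable.clique_union_path hcl huv hu hv (p.mapLe hle) (hp.mapLe hle)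
  have hsub := hB.2 hns Set.subset_union_left
  cases p with
  | nil => exact huv rfl
  | @cons _ w _ hadj q =>
    refine hadj.2 ⟨hu, hsub (.inr ?_)⟩
    simp [Walk.mapLe]

end Nonseparable

/-- The gate structure of a connected block graph. -/
theorem InBlockClass.exists_gateSystem {V : Type*} [Fintype V] {t : ℕ} {b : Fin t → ℕ}
    {G : SimpleGraph V} (hG : G.InBlockClass b) :
    ∃ X : GateSystem V (Fin t), X.graph = G ∧ ∀ i, (X.block i).card = b i := by
  classical
  obtain ⟨-, B, hBcard⟩ := hG.hasBlockOrderSequence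
  have hcl : ∀ i, G.IsClique (B i : Set V) := fun i => hG.isBlockGraph _ (B i).2
  have hmax : ∀ i, Maximal G.IsNonseparable (B i : Set V) := fun i => isBlock_iff.1 (B i).2
  -- After deletion of the edges inside a block, every component meets the block in exactly one
  -- vertex: the gate.
  have hex : ∀ i w, ∃ v ∈ (B i : Set V), (G.deleteInside (B i)).Reachable w v := by
    intro i w
    obtain ⟨b, hb⟩ := (hmax i).1.1
    obtain ⟨p⟩ := hG.connected.preconnected w b
    exact exists_reachable_deleteInside hb p
  choose g hgB hg using hex
  have huniq : ∀ i w, ∀ v ∈ (B i : Set V), (G.deleteInside (B i)).Reachable w v → g i w = v :=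
    fun i w v hv hr => eq_of_reachable_deleteInside (hmax i) (hcl i) (hgB i w) hv
      ((hg i w).symm.trans hr)
  have hgraph : cliqueUnion (fun i => (B i : Set V).toFinset) = G := by
    ext u v
    simp only [cliqueUnion, Set.mem_toFinset]
    constructor
    · rintro ⟨hne, i, hu, hv⟩
      exact hcl i hu hv hne
    · intro h
      have hns : G.IsNonseparable {u, v} := IsClique.isNonseparable
        (isClique_pair.2 fun _ => h) ⟨u, by simp⟩
      obtain ⟨C, hC, hCmax⟩ := Finite.exists_le_maximal hns
      refine ⟨h.ne, B.symm ⟨C, isBlock_iff.2 hCmax⟩, ?_⟩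
      rw [Equiv.apply_symm_apply]
      exact ⟨hC (by simp), hC (by simp)⟩
  let X : GateSystem V (Fin t) :=
    { block := fun i => (B i : Set V).toFinset
      gate := g
      gate_mem := fun i w => Set.mem_toFinset.2 (hgB i w)
      gate_of_mem := fun {i w} hw => huniq i w w (Set.mem_toFinset.1 hw) (Reachable.refl _)
      gate_const := by
        intro i j hij u v hu hv
        rw [Set.mem_toFinset] at hu hv
        by_cases huv : u = v
        · rw [huv]
        -- Two distinct blocks share at most one vertex, so the edge `u v` of block `j` survives the
        -- deletion.
        have hnot : ¬ (u ∈ (B i : Set V) ∧ v ∈ (B i : Set V)) := by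
          rintro ⟨hui, hvi⟩
          have hns := IsNonseparable.union_of_isClique (hcl i) (hcl j) huv hui hvi hu hv
          have h1 := (hmax i).eq_of_subset hns Set.subset_union_left
          have h2 := (hmax j).eq_of_subset hns Set.subset_union_right
          exact hij (B.injective (Subtype.ext (h1.trans h2.symm)))
        have hadj : (G.deleteInside (B i)).Adj u v := ⟨hcl j hu hv huv, hnot⟩
        exact huniq i u _ (hgB i v) (hadj.reachable.trans (hg i v))
      connected := by
        rw [hgraph]
        exact hG.connected }
  refine ⟨X, hgraph, fun i => ?_⟩
  rw [← hBcard i, Set.ncard_eq_toFinset_card']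

/-! ### From gate systems back to block graphs -/

namespace GateSystem

variable {V ι : Type*} (X : GateSystem V ι)

theorem isClique_block (i : ι) : X.graph.IsClique (X.block i : Set V) :=
  fun _ hu _ hv hne => ⟨hne, i, hu, hv⟩

theorem gate_mem_of_isLinked {A : Set V} (hA : X.graph.IsLinked A) {i : ι} {w u : V} (hw : w ∈ A)
    (hu : u ∈ A) (hne : X.gate i w ≠ X.gate i u) : X.gate i w ∈ A := by
  obtain ⟨p, hp⟩ := hA w hw u hu
  exact hp _ (X.gate_left_mem_support p hne)

/-- For `w` outside the block, its gate would separate `w` from another vertex of `S` in the block.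
-/
theorem subset_block_of_isNonseparable {S : Set V} (hS : X.graph.IsNonseparable S) {i : ι}
    {u v : V} (huv : u ≠ v) (hu : u ∈ S) (hv : v ∈ S) (hui : u ∈ X.block i)
    (hvi : v ∈ X.block i) : S ⊆ (X.block i : Set V) := by
  intro w hw
  by_contra hwi
  obtain ⟨z, hz, hzi, hzw⟩ : ∃ z ∈ S, z ∈ X.block i ∧ z ≠ X.gate i w := by
    by_cases h : u = X.gate i w
    · exact ⟨v, hv, hvi, fun h' => huv (h.trans h'.symm)⟩
    · exact ⟨u, hu, hui, h⟩
  have hne : X.gate i w ≠ X.gate i z := by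
    rw [X.gate_of_mem hzi]
    exact hzw.symm
  have hgS : X.gate i w ∈ S := X.gate_mem_of_isLinked hS.2.1 hw hz hne
  have := X.gate_mem_of_isLinked (hS.2.2 _ hgS) (w := w) (u := z)
    ⟨hw, fun h => hwi (by
      rw [Set.mem_singleton_iff.1 h]
      exact X.gate_mem i w)⟩ ⟨hz, hzw⟩ hne
  exact this.2 rfl

theorem eq_of_mem_of_mem {i j : ι} (hij : i ≠ j) {u v : V} (hui : u ∈ X.block i)
    (hvi : v ∈ X.block i) (huj : u ∈ X.block j) (hvj : v ∈ X.block j) : u = v := by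
  rw [← X.gate_of_mem hui, X.gate_const hij huj hvj, X.gate_of_mem hvi]

theorem maximal_block (h2 : ∀ i, 2 ≤ (X.block i).card) (i : ι) :
    Maximal X.graph.IsNonseparable (X.block i : Set V) := by
  obtain ⟨u, hu, v, hv, huv⟩ := Finset.one_lt_card.1 (h2 i)
  exact ⟨(X.isClique_block i).isNonseparable ⟨u, hu⟩, fun S hS hsub =>
    X.subset_block_of_isNonseparable hS huv (hsub hu) (hsub hv) hu hv⟩

theorem exists_mem_block [Nonempty ι] (h2 : ∀ i, 2 ≤ (X.block i).card) (v : V) :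
    ∃ i, v ∈ X.block i := by
  obtain ⟨u, -, hu⟩ := Finset.exists_mem_ne (h2 (Classical.arbitrary ι)) v
  obtain ⟨i, hi, -⟩ := X.exists_block_toward hu.symm
  exact ⟨i, hi⟩

theorem exists_block_eq_of_maximal [Nonempty ι] (h2 : ∀ i, 2 ≤ (X.block i).card) {S : Set V}
    (hS : Maximal X.graph.IsNonseparable S) : ∃ i, (X.block i : Set V) = S := by
  suffices h : ∃ i, S ⊆ (X.block i : Set V) by
    obtain ⟨i, hi⟩ := h
    exact ⟨i, (hS.eq_of_subset (X.maximal_block h2 i).1 hi).symm⟩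
  obtain ⟨x, hx⟩ := hS.1.1
  by_cases hsub : ∀ y ∈ S, y = x
  · obtain ⟨i, hi⟩ := X.exists_mem_block h2 x
    exact ⟨i, fun y hy => by
      rw [hsub y hy]
      exact hi⟩
  · push Not at hsub
    obtain ⟨y, hy, hyx⟩ := hsub
    obtain ⟨p, hp⟩ := hS.1.2.1 x hx y hy
    cases p with
    | nil => exact absurd rfl hyx
    | @cons _ z _ hadj q =>
      have hz := hp z (by simp)
      obtain ⟨hxz, i, hxi, hzi⟩ := hadj
      exact ⟨i, X.subset_block_of_isNonseparable hS.1 hxz hx hz hxi hzi⟩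

theorem inBlockClass [Finite V] {t : ℕ} {b : Fin t → ℕ} (X : GateSystem V (Fin t)) (ht : 1 ≤ t)
    (hb : Antitone b) (hb2 : ∀ i, 2 ≤ b i) (hX : ∀ i, (X.block i).card = b i) :
    X.graph.InBlockClass b := by
  have : Nonempty (Fin t) := ⟨⟨0, ht⟩⟩
  have h2 : ∀ i, 2 ≤ (X.block i).card := fun i => (hb2 i).trans_eq (hX i).symm
  refine ⟨X.connected, ?_, hb, ?_⟩
  · intro S hS
    obtain ⟨i, rfl⟩ := X.exists_block_eq_of_maximal h2 (isBlock_iff.1 hS)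
    exact X.isClique_block i
  · refine ⟨Equiv.ofBijective
      (fun i => ⟨(X.block i : Set V), isBlock_iff.2 (X.maximal_block h2 i)⟩) ⟨?_, ?_⟩, ?_⟩
    · intro i j hij
      by_contra hne
      have he : X.block i = X.block j := Finset.coe_injective (congrArg Subtype.val hij)
      obtain ⟨u, hu, v, hv, huv⟩ := Finset.one_lt_card.1 (h2 i)
      exact huv (X.eq_of_mem_of_mem hne hu hv (he ▸ hu) (he ▸ hv))
    · rintro ⟨S, hS⟩
      obtain ⟨i, hi⟩ := X.exists_block_eq_of_maximal h2 (isBlock_iff.1 hS)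
      exact ⟨i, Subtype.ext hi⟩
    · intro i
      exact (Set.ncard_coe_finset _).trans (hX i)

end GateSystem
end SimpleGraph

/-! ### Transport, the star, and moving a block -/

namespace SimpleGraph
namespace GateSystem

section Transport

variable {V W ι : Type*} (X : GateSystem V ι)

/-- Transport of a gate system along a bijection of the vertices. -/
def transport (e : V ≃ W) : GateSystem W ι where
  block i := (X.block i).map e.toEmbedding
  gate i w := e (X.gate i (e.symm w))
  gate_mem i w := Finset.mem_map_of_mem _ (X.gate_mem i _)
  gate_of_mem := by
    intro i w hw
    obtain ⟨v, hv, rfl⟩ := Finset.mem_map.1 hw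
    simp [X.gate_of_mem hv]
  gate_const := by
    intro i j hij u v hu hv
    obtain ⟨u, hu', rfl⟩ := Finset.mem_map.1 hu
    obtain ⟨v, hv', rfl⟩ := Finset.mem_map.1 hv
    simp [X.gate_const hij hu' hv']
  connected := by
    refine X.connected.map ⟨e, ?_⟩ e.surjective
    rintro a b ⟨hne, i, ha, hb⟩
    exact ⟨fun h => hne (e.injective h), i, Finset.mem_map_of_mem _ ha, Finset.mem_map_of_mem _ hb⟩

theorem card_block_transport (e : V ≃ W) (i : ι) :
    ((X.transport e).block i).card = (X.block i).card :=
  Finset.card_map _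

theorem steinerWiener_transport [Fintype V] [Fintype W] [Fintype ι] (e : V ≃ W) {k : ℕ}
    (hk : 1 ≤ k) : (X.transport e).graph.steinerWiener k = X.graph.steinerWiener k := by
  have hfib : ∀ i v, ((X.transport e).fiber i (e v)).card = (X.fiber i v).card := by
    intro i v
    rw [← Finset.card_map e.toEmbedding]
    congr 1
    ext w
    rw [mem_fiber, Finset.mem_map_equiv, mem_fiber]
    exact e.injective.eq_iff
  have hmiss : ∀ i, (X.transport e).missCount k i = X.missCount k i := by
    intro i
    rw [missCount, missCount]
    refine (Finset.sum_map _ _ _).trans (Finset.sum_congr rfl fun v _ => ?_)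
    rw [← Fintype.card_congr e]
    exact congrArg (fun m => (Fintype.card V - m).choose k) (hfib i v)
  have h1 := (X.transport e).steinerWiener_add_sum_missCount hk
  have h2 := X.steinerWiener_add_sum_missCount hk
  simp only [hmiss, ← Fintype.card_congr e] at h1
  omega

end Transport

section Star

variable {t : ℕ} (b : Fin t → ℕ)

open scoped Classical in
/-- The gate system of a star-like block graph: all blocks share the vertex `none`. -/
noncomputable def star : GateSystem (Option (Σ i, Fin (b i - 1))) (Fin t) where
  -- The condition is vacuous for `none`, which therefore lies in every block.
  block i := Finset.univ.filter fun w => ∀ x, w = some x → x.1 = i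
  gate i w := if ∀ x, w = some x → x.1 = i then w else none
  gate_mem i w := by
    by_cases h : ∀ x, w = some x → x.1 = i
    · rw [if_pos h]
      simpa using h
    · rw [if_neg h]
      simp
  gate_of_mem := by
    intro i w hw
    exact if_pos (Finset.mem_filter.1 hw).2
  gate_const := by
    intro i j hij
    have key : ∀ {w : Option (Σ i, Fin (b i - 1))}, w ∈ (Finset.univ.filter
        fun w : Option (Σ i, Fin (b i - 1)) => ∀ x, w = some x → x.1 = j) →
        (if ∀ x, w = some x → x.1 = i then w else none) = none := by
      intro w hw
      cases w with
      | none => simp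
      | some x =>
        refine if_neg fun h => hij ?_
        rw [← h x rfl, (Finset.mem_filter.1 hw).2 x rfl]
    intro u v hu hv
    rw [key hu, key hv]
  connected := by
    refine Connected.of_isUniversal (v := none) ?_
    intro w hw
    cases w with
    | none => exact absurd rfl hw
    | some x => exact ⟨hw, x.1, by simp, by simp⟩

theorem isUniversal_star : (star b).graph.IsUniversal none := by
  intro w hw
  cases w with
  | none => exact absurd rfl hw
  | some x => exact ⟨hw, x.1, by simp [star], by simp [star]⟩

theorem card_block_star (hb2 : ∀ i, 2 ≤ b i) (i : Fin t) : ((star b).block i).card = b i := by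
  classical
  have h : (star b).block i =
      insert none ((Finset.univ : Finset (Fin (b i - 1))).image fun x => some ⟨i, x⟩) := by
    ext w
    cases w with
    | none => simp [star]
    | some x =>
      obtain ⟨j, x⟩ := x
      simp only [star, Finset.mem_filter, Finset.mem_univ, true_and, Option.some.injEq,
        forall_eq', Finset.mem_insert, reduceCtorEq, Finset.mem_image, false_or]
      constructor
      · rintro rfl
        exact ⟨x, rfl⟩
      · rintro ⟨y, hy⟩
        exact (congrArg Sigma.fst hy).symm
  rw [h, Finset.card_insert_of_notMem (by simp), Finset.card_image_of_injective, Finset.card_univ,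
    Fintype.card_fin]
  · have := hb2 i
    omega
  · intro x y hxy
    simpa using hxy

end Star

section Move

variable {V ι : Type*} (X : GateSystem V ι)

open scoped Classical in
theorem reachable_erase_block [Finite ι] {j : ι} {u v : V} (h : X.gate j u = X.gate j v) :
    (cliqueUnion fun i => if i = j then ∅ else X.block i).Reachable u v := by
  revert h
  refine X.gate_induction (P := fun u => X.gate j u = X.gate j v →
    (cliqueUnion fun i => if i = j then ∅ else X.block i).Reachable u v) v
    (fun _ => Reachable.refl _) ?_ u
  intro u m hu hm ih h
  have hmj : m ≠ j := by
    rintro rfl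
    rw [X.gate_of_mem hu] at h
    exact hm h.symm
  have hadj : (cliqueUnion fun i => if i = j then ∅ else X.block i).Adj u (X.gate m v) := by
    refine ⟨hm.symm, m, ?_⟩
    simp only [if_neg hmj]
    exact ⟨hu, X.gate_mem _ _⟩
  refine hadj.reachable.trans (ih ?_)
  rw [X.gate_const hmj.symm (X.gate_mem m v) hu, h]

open scoped Classical in
/-- Detaching `block j`, together with all that hangs on it, from its vertex `a` and attaching it
to the vertex `c` instead. -/
noncomputable def move [Finite ι] (j : ι) (a c : V) (ha : a ∈ X.block j) (hc : X.gate j c = a) :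
    GateSystem V ι where
  block i := if i = j then insert c ((X.block j).erase a) else X.block i
  -- The vertices beyond `block j` now hang at `c`, which only the blocks separating `a` from `c`
  -- can notice.
  gate i w :=
    if i = j then if X.gate j w = a then c else X.gate j w
    else if X.gate j w ≠ a ∧ X.gate i a ≠ X.gate i c then X.gate i c else X.gate i w
  gate_mem i w := by
    split_ifs with hij h h
    · simp
    · exact Finset.mem_insert_of_mem (Finset.mem_erase.2 ⟨h, X.gate_mem _ _⟩)
    · exact X.gate_mem _ _
    · exact X.gate_mem _ _
  gate_of_mem := by
    intro i w hw
    by_cases hij : i = j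
    · rw [if_pos hij] at hw ⊢
      rcases Finset.mem_insert.1 hw with rfl | hw
      · rw [if_pos hc]
      · rw [X.gate_of_mem (Finset.mem_of_mem_erase hw), if_neg (Finset.ne_of_mem_erase hw)]
    · rw [if_neg hij] at hw ⊢
      rw [if_neg, X.gate_of_mem hw]
      -- A block separating `a` from `c` lies on their common side of `block j`, so none of its
      -- vertices is beyond.
      rintro ⟨h1, h2⟩
      have h3 : X.gate j a = X.gate j c := by rw [hc, X.gate_of_mem ha]
      have := X.gate_eq_of_gate_ne h3 h2 hw
      rw [X.gate_of_mem ha] at this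
      exact h1 this
  gate_const := by
    intro i l hil u v hu hv
    by_cases hlj : l = j
    · rw [if_pos hlj] at hu hv
      have hij : i ≠ j := fun h => hil (h.trans hlj.symm)
      simp only [if_neg hij]
      have key : ∀ {w}, w ∈ insert c ((X.block j).erase a) →
          (if X.gate j w ≠ a ∧ X.gate i a ≠ X.gate i c then X.gate i c else X.gate i w) =
            X.gate i c := by
        intro w hw
        rcases Finset.mem_insert.1 hw with rfl | hw
        · simp
        · have hwj := Finset.mem_of_mem_erase hw
          by_cases h : X.gate i a = X.gate i c
          · rw [if_neg (fun h' => h'.2 h), X.gate_const hij hwj ha, h]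
          · rw [if_pos]
            rw [X.gate_of_mem hwj]
            exact ⟨Finset.ne_of_mem_erase hw, h⟩
      rw [key hu, key hv]
    · rw [if_neg hlj] at hu hv
      have h1 : X.gate j u = X.gate j v := X.gate_const (fun h => hlj h.symm) hu hv
      by_cases hij : i = j
      · simp only [if_pos hij, h1]
      · simp only [if_neg hij, h1, X.gate_const hil hu hv]
  connected := by
    set G' := cliqueUnion fun i => if i = j then insert c ((X.block j).erase a) else X.block i
    have hle : (cliqueUnion fun i => if i = j then ∅ else X.block i) ≤ G' := by
      rintro u v ⟨hne, i, hu, hv⟩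
      by_cases hij : i = j
      · simp [hij] at hu
      · simp only [if_neg hij] at hu hv
        refine ⟨hne, i, ?_⟩
        simp only [if_neg hij]
        exact ⟨hu, hv⟩
    have : Nonempty V := ⟨a⟩
    have hreach : ∀ w, G'.Reachable w c := by
      intro w
      by_cases hw : X.gate j w = a
      · exact (X.reachable_erase_block (hw.trans hc.symm)).mono hle
      · have h1 : G'.Reachable w (X.gate j w) :=
          (X.reachable_erase_block (X.gate_of_mem (X.gate_mem j w)).symm).mono hle
        have h2 : G'.Adj (X.gate j w) c := by
          refine ⟨?_, j, ?_⟩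
          · intro h
            have := X.gate_of_mem (X.gate_mem j w)
            rw [h, hc] at this
            exact hw (h.trans this.symm)
          · simp only [if_true]
            exact ⟨Finset.mem_insert_of_mem (Finset.mem_erase.2 ⟨hw, X.gate_mem _ _⟩), by simp⟩
        exact h1.trans h2.reachable
    exact ⟨fun u v => (hreach u).trans (hreach v).symm⟩

variable {j : ι} {a c : V} (ha : a ∈ X.block j) (hc : X.gate j c = a)

open scoped Classical in
/-- The vertices that are separated from `a` by `block j`. -/
noncomputable def beyond [Fintype V] (j : ι) (a : V) : Finset V :=
  Finset.univ.filter fun w => X.gate j w ≠ a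

@[simp]
theorem mem_beyond [Fintype V] {w : V} : w ∈ X.beyond j a ↔ X.gate j w ≠ a := by simp [beyond]

theorem card_block_move [Finite ι] (hca : c ≠ a) (i : ι) :
    ((X.move j a c ha hc).block i).card = (X.block i).card := by
  classical
  have hcj : c ∉ X.block j := fun h => hca (by rw [← hc, X.gate_of_mem h])
  by_cases hij : i = j
  · subst hij
    simp only [move, if_true]
    rw [Finset.card_insert_of_notMem fun h => hcj (Finset.mem_of_mem_erase h),
      Finset.card_erase_of_mem ha]
    exact Nat.sub_add_cancel (Finset.card_pos.2 ⟨a, ha⟩)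
  · simp only [move, if_neg hij]

theorem missCount_move_self [Fintype V] [Finite ι] (hca : c ≠ a) (k : ℕ) :
    (X.move j a c ha hc).missCount k j = X.missCount k j := by
  classical
  have hcj : c ∉ X.block j := fun h => hca (by rw [← hc, X.gate_of_mem h])
  have hb : (X.move j a c ha hc).block j = insert c ((X.block j).erase a) := by simp [move]
  have hfc : (X.move j a c ha hc).fiber j c = X.fiber j a := by
    ext w
    simp only [mem_fiber, move, if_true]
    by_cases hw : X.gate j w = a
    · simp [hw]
    · rw [if_neg hw]
      exact ⟨fun h => absurd (h ▸ X.gate_mem j w) hcj, fun h => absurd h hw⟩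
  have hfv : ∀ v ∈ (X.block j).erase a, (X.move j a c ha hc).fiber j v = X.fiber j v := by
    intro v hv
    ext w
    simp only [mem_fiber, move, if_true]
    by_cases hw : X.gate j w = a
    · rw [if_pos hw, hw]
      refine ⟨fun h => absurd ?_ hcj, fun h => absurd h.symm (Finset.ne_of_mem_erase hv)⟩
      rw [h]
      exact Finset.mem_of_mem_erase hv
    · rw [if_neg hw]
  rw [missCount, missCount, hb, Finset.sum_insert fun h => hcj (Finset.mem_of_mem_erase h), hfc,
    ← Finset.add_sum_erase _ _ ha]
  congr 1
  exact Finset.sum_congr rfl fun v hv => by rw [hfv v hv]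

theorem missCount_move_of_eq [Fintype V] [Finite ι] {i : ι} (hij : i ≠ j) (h : X.gate i a = X.gate i c) (k : ℕ) :
    (X.move j a c ha hc).missCount k i = X.missCount k i := by
  have hb : (X.move j a c ha hc).block i = X.block i := by simp [move, hij]
  have hf : ∀ v, (X.move j a c ha hc).fiber i v = X.fiber i v := by
    intro v
    ext w
    simp [move, hij, h]
  simp only [missCount, hb, hf]

/-- The effect of a move on a block that separates `a` from `c`. -/
theorem missCount_move_of_ne [Fintype V] [Finite ι] {i : ι} (hij : i ≠ j) (h : X.gate i a ≠ X.gate i c) (k : ℕ) :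
    (X.move j a c ha hc).missCount k i +
        (Fintype.card V - (X.fiber i (X.gate i c)).card).choose k +
        (Fintype.card V - (X.fiber i (X.gate i a)).card).choose k =
      X.missCount k i +
        (Fintype.card V - ((X.fiber i (X.gate i c)).card + (X.beyond j a).card)).choose k +
        (Fintype.card V - ((X.fiber i (X.gate i a)).card - (X.beyond j a).card)).choose k := by
  classical
  have hb : (X.move j a c ha hc).block i = X.block i := by simp [move, hij]
  -- Seen from `block i`, everything beyond `block j` lies behind the gate of `a`; this whole set
  -- changes to the fiber of the gate of `c`.
  have hbey : ∀ w, X.gate j w ≠ a → X.gate i w = X.gate i a := by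
    intro w hw
    have h3 : X.gate j a = X.gate j c := by rw [hc, X.gate_of_mem ha]
    have := X.gate_eq_of_gate_ne h3 h (X.gate_mem i a)
    rw [X.gate_of_mem ha] at this
    exact X.gate_eq_gate hij (X.gate_mem i a) this hw
  have hgate : ∀ w, (X.move j a c ha hc).gate i w =
      if X.gate j w ≠ a then X.gate i c else X.gate i w := by
    intro w
    simp only [move, if_neg hij, h, ne_eq, not_false_eq_true, and_true]
  have hfc : ((X.move j a c ha hc).fiber i (X.gate i c)).card =
      (X.fiber i (X.gate i c)).card + (X.beyond j a).card := by
    rw [← Finset.card_union_of_disjoint]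
    · congr 1
      ext w
      simp only [Finset.mem_union, mem_fiber, mem_beyond, hgate]
      by_cases hw : X.gate j w = a <;> simp [hw]
    · refine Finset.disjoint_left.2 fun w hw hw' => h ?_
      rw [mem_fiber] at hw
      rw [mem_beyond] at hw'
      rw [← hbey w hw', hw]
  have hfa : ((X.move j a c ha hc).fiber i (X.gate i a)).card =
      (X.fiber i (X.gate i a)).card - (X.beyond j a).card := by
    rw [← Finset.card_sdiff_of_subset]
    · congr 1
      ext w
      simp only [Finset.mem_sdiff, mem_fiber, mem_beyond, hgate]
      by_cases hw : X.gate j w = a <;> simp [hw, Ne.symm h]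
    · intro w hw
      rw [mem_beyond] at hw
      rw [mem_fiber, hbey w hw]
  have hfv : ∀ v, v ≠ X.gate i c → v ≠ X.gate i a →
      (X.move j a c ha hc).fiber i v = X.fiber i v := by
    intro v hvc hva
    ext w
    simp only [mem_fiber, hgate]
    by_cases hw : X.gate j w = a
    · simp [hw]
    · simp only [ne_eq, hw, not_false_eq_true, if_true, hbey w hw]
      exact ⟨fun h => absurd h.symm hvc, fun h => absurd h.symm hva⟩
  have hmem : X.gate i a ∈ (X.block i).erase (X.gate i c) :=
    Finset.mem_erase.2 ⟨h, X.gate_mem _ _⟩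
  rw [missCount, missCount, hb, ← Finset.add_sum_erase _ _ (X.gate_mem i c),
    ← Finset.add_sum_erase _ _ hmem, ← Finset.add_sum_erase _ _ (X.gate_mem i c),
    ← Finset.add_sum_erase _ _ hmem, hfc, hfa]
  rw [Finset.sum_congr rfl fun v hv => by
    rw [hfv v (Finset.ne_of_mem_erase (Finset.mem_of_mem_erase hv)) (Finset.ne_of_mem_erase hv)]]
  ring

theorem card_fiber_le [Fintype V] (i : ι) (v : V) : (X.fiber i v).card ≤ Fintype.card V :=
  Finset.card_le_univ _

theorem card_beyond_pos [Fintype V] (h2 : ∀ i, 2 ≤ (X.block i).card) (j : ι) (a : V) :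
    0 < (X.beyond j a).card := by
  obtain ⟨u, hu, hne⟩ := Finset.exists_mem_ne (h2 j) a
  exact Finset.card_pos.2 ⟨u, X.mem_beyond.2 (by rwa [X.gate_of_mem hu])⟩

end Move

end GateSystem
end SimpleGraph

/-! ### Improving moves -/

/-- Fiber sizes `x` and `y` become `x + d` and `y - d`, both still between `x` and `y`: a more
balanced pair misses fewer sets. -/
theorem Nat.choose_sub_add_choose_sub_le {n x y d : ℕ} (hxy : x + d ≤ y) (hy : y ≤ n) (k : ℕ) :
    (n - (x + d)).choose k + (n - (y - d)).choose k ≤ (n - x).choose k + (n - y).choose k := by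
  have h := Nat.choose_add_choose_le_of_le (show n - y ≤ n - (x + d) by omega) d k
  rw [show n - y + d = n - (y - d) by omega, show n - (x + d) + d = n - x by omega] at h
  omega

theorem Nat.choose_two_sub_add_choose_two_sub_lt {n x y d : ℕ} (hd : 0 < d) (hxy : x + d < y)
    (hy : y ≤ n) :
    (n - (x + d)).choose 2 + (n - (y - d)).choose 2 < (n - x).choose 2 + (n - y).choose 2 := by
  have h := Nat.choose_two_add_choose_two_lt (show n - y < n - (x + d) by omega) hd
  rw [show n - y + d = n - (y - d) by omega, show n - (x + d) + d = n - x by omega] at h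
  omega

namespace SimpleGraph
namespace GateSystem

variable {V ι : Type*} [Fintype V] [Fintype ι] (X : GateSystem V ι)

/-- `Y` has the same block orders as `X`, no smaller Steiner Wiener indices, and a larger
Wiener index. -/
def IsImprovedBy (Y : GateSystem V ι) : Prop :=
  (∀ i, (Y.block i).card = (X.block i).card) ∧
    (∀ k, 1 ≤ k → X.graph.steinerWiener k ≤ Y.graph.steinerWiener k) ∧
    X.graph.steinerWiener 2 < Y.graph.steinerWiener 2

variable {X}

theorem IsImprovedBy.of_missCount {Y : GateSystem V ι}
    (hcard : ∀ i, (Y.block i).card = (X.block i).card)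
    (hle : ∀ k, ∑ i, Y.missCount k i ≤ ∑ i, X.missCount k i)
    (hlt : ∑ i, Y.missCount 2 i < ∑ i, X.missCount 2 i) : X.IsImprovedBy Y := by
  refine ⟨hcard, fun k hk => ?_, ?_⟩
  · have h1 := X.steinerWiener_add_sum_missCount hk
    have h2 := Y.steinerWiener_add_sum_missCount hk
    have := hle k
    omega
  · have h1 := X.steinerWiener_add_sum_missCount one_le_two
    have h2 := Y.steinerWiener_add_sum_missCount one_le_two
    omega

variable (X)

theorem missCount_move_le {i j : ι} {a c : V} (ha : a ∈ X.block j) (hc : X.gate j c = a)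
    (hij : i ≠ j) (h : X.gate i a ≠ X.gate i c)
    (hle : (X.fiber i (X.gate i c)).card + (X.beyond j a).card ≤ (X.fiber i (X.gate i a)).card)
    (k : ℕ) : (X.move j a c ha hc).missCount k i ≤ X.missCount k i := by
  have h1 := X.missCount_move_of_ne ha hc hij h k
  have h2 := Nat.choose_sub_add_choose_sub_le hle (X.card_fiber_le i _) k
  omega

/-- Move `block j` from `a` to a vertex `c` of `block l`. Only the count of `block l` can change.
There the fiber of `a` contains `a` and all that lies beyond blocks `i` and `j`, so it exceeds the
fiber of `c` by more than the amount moved. -/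
theorem exists_isImprovedBy_of_card_beyond_le (h2 : ∀ i, 2 ≤ (X.block i).card) {a : V}
    {i l j : ι} (hil : i ≠ l) (hij : i ≠ j) (hlj : l ≠ j) (hi : a ∈ X.block i)
    (hl : a ∈ X.block l) (ha : a ∈ X.block j)
    (hle : (X.beyond l a).card ≤ (X.beyond i a).card) : ∃ Y, X.IsImprovedBy Y := by
  classical
  obtain ⟨c, hcl, hca⟩ := Finset.exists_mem_ne (h2 l) a
  have hc : X.gate j c = a := by rw [X.gate_const hlj.symm hcl hl, X.gate_of_mem ha]
  have hne : X.gate l a ≠ X.gate l c := by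
    rw [X.gate_of_mem hl, X.gate_of_mem hcl]
    exact hca.symm
  have hx : (X.fiber l (X.gate l c)).card ≤ (X.beyond l a).card := by
    refine Finset.card_le_card fun w hw => ?_
    rw [mem_fiber, X.gate_of_mem hcl] at hw
    rw [mem_beyond, hw]
    exact hca
  have hy : (X.beyond i a).card + (X.beyond j a).card + 1 ≤ (X.fiber l (X.gate l a)).card := by
    rw [X.gate_of_mem hl, ← Finset.card_union_of_disjoint,
      ← Finset.card_insert_of_notMem (a := a)]
    · refine Finset.card_le_card fun w hw => ?_
      rw [mem_fiber]
      rcases Finset.mem_insert.1 hw with rfl | hw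
      · exact X.gate_of_mem hl
      rcases Finset.mem_union.1 hw with hw | hw
      · exact X.gate_eq_self_of_gate_ne hil.symm hl hi (X.mem_beyond.1 hw)
      · exact X.gate_eq_self_of_gate_ne hlj hl ha (X.mem_beyond.1 hw)
    · simp [X.gate_of_mem hi, X.gate_of_mem ha]
    · refine Finset.disjoint_left.2 fun w hw hw' => ?_
      exact X.mem_beyond.1 hw' (X.gate_eq_self_of_gate_ne hij.symm ha hi (X.mem_beyond.1 hw))
  have hpos := X.card_beyond_pos h2 j a
  have hmiss : ∀ k m, (X.move j a c ha hc).missCount k m ≤ X.missCount k m := by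
    intro k m
    rcases eq_or_ne m j with rfl | hmj
    · exact (X.missCount_move_self ha hc hca k).le
    rcases eq_or_ne m l with rfl | hml
    · exact X.missCount_move_le ha hc hmj hne (by omega) k
    · exact (X.missCount_move_of_eq ha hc hmj (X.gate_const hml hl hcl) k).le
  refine ⟨X.move j a c ha hc, .of_missCount (X.card_block_move ha hc hca)
    (fun k => Finset.sum_le_sum fun m _ => hmiss k m)
    (Finset.sum_lt_sum (fun m _ => hmiss 2 m) ⟨l, Finset.mem_univ _, ?_⟩)⟩
  have h1 := X.missCount_move_of_ne ha hc hlj hne 2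
  have h2 := Nat.choose_two_sub_add_choose_two_sub_lt hpos
    (show (X.fiber l (X.gate l c)).card + _ < (X.fiber l (X.gate l a)).card by omega)
    (X.card_fiber_le l _)
  omega

/-- A vertex contained in three blocks allows an improvement. -/
theorem exists_isImprovedBy_of_mem_three (h2 : ∀ i, 2 ≤ (X.block i).card) {a : V}
    {i l j : ι} (hil : i ≠ l) (hij : i ≠ j) (hlj : l ≠ j) (hi : a ∈ X.block i)
    (hl : a ∈ X.block l) (ha : a ∈ X.block j) : ∃ Y, X.IsImprovedBy Y := by
  rcases le_total (X.beyond l a).card (X.beyond i a).card with h | h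
  · exact X.exists_isImprovedBy_of_card_beyond_le h2 hil hij hlj hi hl ha h
  · exact X.exists_isImprovedBy_of_card_beyond_le h2 hil.symm hlj hij hl hi ha h

/-- Behind a cut vertex `q` of `block i` there is a vertex contained in one block only. -/
theorem exists_card_fiber_eq_one (h2 : ∀ i, 2 ≤ (X.block i).card) {i l : ι} {q : V}
    (hil : i ≠ l) (hi : q ∈ X.block i) (hl : q ∈ X.block l) :
    ∃ m c, c ∈ X.block m ∧ X.gate i c = q ∧ X.gate m q ≠ c ∧ (X.fiber m c).card = 1 := by
  classical
  let P : ℕ → Prop := fun s =>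
    ∃ m c, c ∈ X.block m ∧ X.gate i c = q ∧ X.gate m q ≠ c ∧ (X.fiber m c).card = s
  have hex : ∃ s, P s := by
    obtain ⟨c, hc, hcq⟩ := Finset.exists_mem_ne (h2 l) q
    refine ⟨_, l, c, hc, ?_, ?_, rfl⟩
    · rw [X.gate_const hil hc hl, X.gate_of_mem hi]
    · rw [X.gate_of_mem hl]
      exact hcq.symm
  -- Among all such pairs behind `q`, one with the smallest fiber. A further vertex `w` in that
  -- fiber would yield, one step from `c` towards `w`, a smaller one.
  obtain ⟨m, c, hcm, hic, hmq, hcard⟩ := Nat.find_spec hex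
  refine ⟨m, c, hcm, hic, hmq, ?_⟩
  by_contra hone
  have hcc : c ∈ X.fiber m c := X.mem_fiber.2 (X.gate_of_mem hcm)
  obtain ⟨w, hw, hwc⟩ := Finset.exists_mem_ne
    (show 1 < (X.fiber m c).card by
      have := Finset.card_pos.2 ⟨c, hcc⟩
      omega) c
  rw [mem_fiber] at hw
  obtain ⟨m', hcm', hne⟩ := X.exists_block_toward hwc.symm
  have hmm : m ≠ m' := by
    rintro rfl
    exact hne hw
  have him : i ≠ m' := by
    rintro rfl
    rw [X.gate_of_mem hcm'] at hic
    subst hic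
    exact hmq (X.gate_of_mem hcm)
  refine Nat.find_min hex (m := (X.fiber m' (X.gate m' w)).card) ?_
    ⟨m', _, X.gate_mem m' w, ?_, ?_, rfl⟩
  · rw [← hcard]
    refine Finset.card_lt_card ((Finset.ssubset_iff_of_subset fun z hz => ?_).2 ⟨c, hcc, ?_⟩)
    · rw [mem_fiber] at hz ⊢
      exact X.gate_eq_self_of_gate_ne hmm hcm hcm' (by rwa [hz])
    · rw [mem_fiber, X.gate_of_mem hcm']
      exact hne.symm
  · rw [X.gate_const him (X.gate_mem m' w) hcm', hic]
  · rw [X.gate_eq_self_of_gate_ne hmm.symm hcm' hcm hmq]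
    exact hne.symm

/-- Move `block j` from `a` to a vertex `c` behind `q` that has a singleton fiber in its block `m`.
Blocks other than `i` that separate `a` from `c` become more balanced, since the fibers of `p` and
`a` both lie on the `a` side. The count of `block i` alone may grow; `block m` compensates for it.
-/
theorem exists_isImprovedBy_of_card_fiber_le (h2 : ∀ i, 2 ≤ (X.block i).card) {i j l : ι}
    {p q a : V} (hpa : p ≠ a) (hqa : q ≠ a) (hpq : p ≠ q) (hq : q ∈ X.block i)
    (hai : a ∈ X.block i) (hil : i ≠ l) (hql : q ∈ X.block l) (hij : i ≠ j) (ha : a ∈ X.block j)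
    (hle : (X.fiber i q).card ≤ (X.fiber i p).card) : ∃ Y, X.IsImprovedBy Y := by
  classical
  obtain ⟨m, c, hcm, hic, hmq, hone⟩ := X.exists_card_fiber_eq_one h2 hil hq hql
  have hc : X.gate j c = a := X.gate_eq_self_of_gate_ne hij.symm ha hai (by rwa [hic])
  have hca : c ≠ a := by
    rintro rfl
    rw [X.gate_of_mem hai] at hic
    exact hqa hic.symm
  have him : i ≠ m := by
    rintro rfl
    rw [X.gate_of_mem hcm] at hic
    exact hmq ((X.gate_of_mem hq).trans hic.symm)
  have hmj : m ≠ j := by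
    rintro rfl
    rw [X.gate_of_mem hcm] at hc
    exact hca hc
  have hpos := X.card_beyond_pos h2 j a
  have hia : X.gate i a = a := X.gate_of_mem hai
  have hfa : (X.beyond j a).card + 1 ≤ (X.fiber i a).card := by
    rw [← Finset.card_insert_of_notMem (a := a) (by simp [X.gate_of_mem ha])]
    refine Finset.card_le_card fun w hw => ?_
    rw [mem_fiber]
    rcases Finset.mem_insert.1 hw with rfl | hw
    · exact hia
    · exact X.gate_eq_self_of_gate_ne hij hai ha (X.mem_beyond.1 hw)
  have hnei : X.gate i a ≠ X.gate i c := by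
    rw [hia, hic]
    exact hqa.symm
  have hmq' : X.gate m a = X.gate m q := X.gate_const him.symm hai hq
  have hnem : X.gate m a ≠ X.gate m c := by rwa [hmq', X.gate_of_mem hcm]
  -- A block other than `i` that separates `a` from `c` lies behind `q`, so it sees all vertices not
  -- behind `q` at the gate of `a`.
  have hsep : ∀ e, e ≠ i → X.gate e a ≠ X.gate e c → ∀ w, X.gate i w ≠ q →
      X.gate e w = X.gate e a := by
    intro e hei hne w hw
    have he : X.gate e a = X.gate e q := X.gate_const hei hai hq
    rw [he] at hne ⊢
    have hiq : X.gate i q = q := X.gate_of_mem hq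
    have := X.gate_eq_of_gate_ne (j := i) (hiq.trans hic.symm) hne (X.gate_mem e q)
    exact X.gate_eq_gate hei (X.gate_mem e q) (this.trans hiq) hw
  have hy : ∀ e, e ≠ i → X.gate e a ≠ X.gate e c →
      (X.fiber i q).card + (X.beyond j a).card < (X.fiber e (X.gate e a)).card := by
    intro e hei hne
    have : (X.fiber i p).card + (X.fiber i a).card ≤ (X.fiber e (X.gate e a)).card := by
      rw [← Finset.card_union_of_disjoint]
      · refine Finset.card_le_card fun w hw => X.mem_fiber.2 (hsep e hei hne w ?_)
        rcases Finset.mem_union.1 hw with hw | hw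
        · rwa [X.mem_fiber.1 hw]
        · rw [X.mem_fiber.1 hw]
          exact hqa.symm
      · refine Finset.disjoint_left.2 fun w hw hw' => hpa ?_
        rw [← X.mem_fiber.1 hw, X.mem_fiber.1 hw']
    omega
  have hx : ∀ e, e ≠ i → X.gate e a ≠ X.gate e c →
      (X.fiber e (X.gate e c)).card ≤ (X.fiber i q).card := by
    intro e hei hne
    refine Finset.card_le_card fun w hw => X.mem_fiber.2 ?_
    by_contra hw'
    exact hne (by rw [← hsep e hei hne w hw', X.mem_fiber.1 hw])
  set Y := X.move j a c ha hc with hY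
  have hrest : ∀ k, ∀ e ∈ (Finset.univ.erase i).erase m, Y.missCount k e ≤ X.missCount k e := by
    intro k e he
    have hei : e ≠ i := Finset.ne_of_mem_erase (Finset.mem_of_mem_erase he)
    rcases eq_or_ne e j with rfl | hej
    · exact (X.missCount_move_self ha hc hca k).le
    by_cases hne : X.gate e a = X.gate e c
    · exact (X.missCount_move_of_eq ha hc hej hne k).le
    · have h3 := hy e hei hne
      have h4 := hx e hei hne
      exact X.missCount_move_le ha hc hej hne (by omega) k
  have hsplit : ∀ (Z : GateSystem V ι) k, ∑ e, Z.missCount k e = Z.missCount k i +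
      (Z.missCount k m + ∑ e ∈ (Finset.univ.erase i).erase m, Z.missCount k e) := by
    intro Z k
    rw [Finset.add_sum_erase _ _ (Finset.mem_erase.2 ⟨him.symm, Finset.mem_univ _⟩),
      Finset.add_sum_erase _ _ (Finset.mem_univ _)]
  have hmi := fun k => X.missCount_move_of_ne ha hc hij hnei k
  have hmm := fun k => X.missCount_move_of_ne ha hc hmj hnem k
  simp only [hia, hic] at hmi
  simp only [X.gate_of_mem hcm, hone] at hmm
  have hym := hy m him.symm hnem
  refine ⟨Y, .of_missCount (X.card_block_move ha hc hca) (fun k => ?_) ?_⟩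
  · have h1 := Nat.choose_sub_add_choose_sub_le (x := 1) (d := (X.beyond j a).card)
      (show 1 + _ ≤ (X.fiber i a).card by omega) (X.card_fiber_le i _) k
    have h3 := Nat.choose_sub_add_choose_sub_le hym.le (X.card_fiber_le m _) k
    have h4 := Finset.sum_le_sum (hrest k)
    have h5 := hmi k
    have h6 := hmm k
    rw [← hY] at h5 h6
    rw [hsplit Y, hsplit X]
    omega
  · have h1 := Nat.choose_sub_add_choose_sub_le (x := 1) (d := (X.beyond j a).card)
      (show 1 + _ ≤ (X.fiber i a).card by omega) (X.card_fiber_le i _) 2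
    have h3 := Nat.choose_two_sub_add_choose_two_sub_lt hpos hym (X.card_fiber_le m _)
    have h4 := Finset.sum_le_sum (hrest 2)
    have h5 := hmi 2
    have h6 := hmm 2
    rw [← hY] at h5 h6
    rw [hsplit Y, hsplit X]
    omega

/-- A block with three cut vertices allows an improvement. -/
theorem exists_isImprovedBy_of_three_cut (h2 : ∀ i, 2 ≤ (X.block i).card) {i j l m : ι}
    {p q a : V} (hpa : p ≠ a) (hqa : q ≠ a) (hpq : p ≠ q) (hp : p ∈ X.block i)
    (hq : q ∈ X.block i) (hai : a ∈ X.block i) (him : i ≠ m) (hpm : p ∈ X.block m)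
    (hil : i ≠ l) (hql : q ∈ X.block l) (hij : i ≠ j) (ha : a ∈ X.block j) :
    ∃ Y, X.IsImprovedBy Y := by
  rcases le_total (X.fiber i q).card (X.fiber i p).card with h | h
  · exact X.exists_isImprovedBy_of_card_fiber_le h2 hpa hqa hpq hq hai hil hql hij ha h
  · exact X.exists_isImprovedBy_of_card_fiber_le h2 hqa hpa hpq.symm hp hai him hpm hij ha h

end GateSystem
end SimpleGraph

/-! ### Paths, caterpillars and line graphs -/

namespace SimpleGraph

theorem Connected.exists_adj_dist_eq {V : Type*} {G : SimpleGraph V} (hG : G.Connected) {u r : V}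
    {d : ℕ} (h : G.dist u r = d + 1) : ∃ w, G.Adj u w ∧ G.dist w r = d := by
  obtain ⟨p, hp⟩ := hG.exists_walk_length_eq_dist u r
  rw [h] at hp
  cases p with
  | nil => simp at hp
  | @cons _ w _ hadj q =>
    refine ⟨w, hadj, ?_⟩
    have h1 := dist_le q
    have h2 := hG.dist_triangle (u := u) (v := w) (w := r)
    rw [dist_eq_one_iff_adj.2 hadj] at h2
    rw [Walk.length_cons] at hp
    omega

/-- A finite connected graph of maximum degree at most two that has a vertex of degree at most
one is a path. -/
theorem Connected.nonempty_iso_pathGraph {V : Type*} [Fintype V] {G : SimpleGraph V}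
    (hG : G.Connected)
    (hdeg : ∀ v x y z, G.Adj v x → G.Adj v y → G.Adj v z → x = y ∨ x = z ∨ y = z) {r : V}
    (hr : ∀ x y, G.Adj r x → G.Adj r y → x = y) :
    Nonempty (G ≃g pathGraph (Fintype.card V)) := by
  classical
  -- Distance from `r` is injective: of the at most two neighbours of a vertex other than `r`, one
  -- is nearer to `r`, so at most one is farther.
  have hinj' : ∀ d u v, G.dist u r = d → G.dist v r = d → u = v := by
    intro d
    induction d with
    | zero =>
      intro u v hu hv
      rw [hG.dist_eq_zero_iff] at hu hv
      rw [hu, hv]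
    | succ d ih =>
      intro u v hu hv
      obtain ⟨w, huw, hw⟩ := hG.exists_adj_dist_eq hu
      obtain ⟨w', hvw, hw'⟩ := hG.exists_adj_dist_eq hv
      obtain rfl := ih w w' hw hw'
      cases d with
      | zero =>
        rw [hG.dist_eq_zero_iff] at hw
        subst hw
        exact hr _ _ huw.symm hvw.symm
      | succ d =>
        obtain ⟨z, hwz, hz⟩ := hG.exists_adj_dist_eq hw
        rcases hdeg w u v z huw.symm hvw.symm hwz with h | h | h
        · exact h
        · subst h
          omega
        · subst h
          omega
  have hlt : ∀ v, G.dist v r < Fintype.card V := by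
    intro v
    obtain ⟨p, hp, hlen⟩ := hG.exists_path_of_dist v r
    rw [← hlen]
    exact hp.length_lt
  let f : V → Fin (Fintype.card V) := fun v => ⟨G.dist v r, hlt v⟩
  have hf : Function.Injective f := fun u v h => hinj' _ u v (congrArg Fin.val h) rfl
  have hbij : Function.Bijective f := by
    rw [Fintype.bijective_iff_injective_and_card]
    exact ⟨hf, by simp⟩
  have hstep : ∀ {u v}, G.dist u r + 1 = G.dist v r → G.Adj u v := by
    intro u v h
    obtain ⟨w, hvw, hw⟩ := hG.exists_adj_dist_eq h.symm
    obtain rfl := hinj' _ _ _ hw rfl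
    exact hvw.symm
  refine ⟨⟨Equiv.ofBijective f hbij, ?_⟩⟩
  intro u v
  rw [pathGraph_adj]
  constructor
  · rintro (h | h)
    · exact hstep h
    · exact (hstep h).symm
  · intro h
    have h1 := hG.dist_triangle (u := u) (v := v) (w := r)
    have h2 := hG.dist_triangle (u := v) (v := u) (w := r)
    rw [dist_eq_one_iff_adj.2 h] at h1
    rw [dist_eq_one_iff_adj.2 h.symm] at h2
    have h3 : G.dist u r ≠ G.dist v r := fun h' => h.ne (hinj' _ _ _ h' rfl)
    change G.dist u r + 1 = G.dist v r ∨ G.dist v r + 1 = G.dist u r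
    omega

theorem IsCaterpillar.of_iso {V W : Type*} {T : SimpleGraph V} {T' : SimpleGraph W}
    (f : T ≃g T') (hT : T.IsCaterpillar) : T'.IsCaterpillar := by
  obtain ⟨htree, m, ⟨g⟩⟩ := hT
  have hiff : ∀ w, w ∈ {v | ¬ ∃! w, T'.Adj v w} ↔ f.symm w ∈ {v | ¬ ∃! w, T.Adj v w} := by
    intro w
    refine not_congr ?_
    refine (f.symm.toEquiv.existsUnique_congr ?_)
    intro a
    exact f.symm.map_adj_iff.symm
  let e : T'.induce {v | ¬ ∃! w, T'.Adj v w} ≃g T.induce {v | ¬ ∃! w, T.Adj v w} :=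
    { toEquiv := f.symm.toEquiv.subtypeEquiv hiff
      map_rel_iff' := f.symm.map_adj_iff }
  exact ⟨f.isTree_iff.1 htree, m, ⟨e.trans g⟩⟩

theorem IsPathLike.of_iso_lineGraph {V W : Type*} [Finite W] {G : SimpleGraph V}
    {T : SimpleGraph W} (hT : T.IsCaterpillar) (f : G ≃g T.lineGraph) : G.IsPathLike := by
  have := Fintype.ofFinite W
  exact ⟨Fintype.card W, T.overFin rfl, hT.of_iso (T.overFinIso rfl),
    ⟨f.trans (T.overFinIso rfl).lineGraph⟩⟩

/-- The graph whose edges are given by an incidence relation `inc` between edges and vertices. -/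
def ofIncidence {V P : Type*} (inc : V → P → Prop) : SimpleGraph P where
  Adj p q := p ≠ q ∧ ∃ x, inc x p ∧ inc x q
  symm := ⟨fun _ _ ⟨h, x, hp, hq⟩ => ⟨h.symm, x, hq, hp⟩⟩
  loopless := ⟨fun _ h => h.1 rfl⟩

/-- Each `x` becomes the edge joining its two incident points; `hinj` excludes parallel edges. -/
theorem nonempty_iso_lineGraph_ofIncidence {V P : Type*} {G : SimpleGraph V}
    {inc : V → P → Prop} (h2 : ∀ x, ∃ p q, p ≠ q ∧ ∀ r, inc x r ↔ r = p ∨ r = q)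
    (hinj : ∀ {p q}, p ≠ q → ∀ {x y}, inc x p → inc x q → inc y p → inc y q → x = y)
    (hG : ∀ x y, G.Adj x y ↔ x ≠ y ∧ ∃ p, inc x p ∧ inc y p) :
    Nonempty (G ≃g (ofIncidence inc).lineGraph) := by
  choose p q hpq hinc using h2
  have hp : ∀ x, inc x (p x) := fun x => (hinc x _).2 (.inl rfl)
  have hq : ∀ x, inc x (q x) := fun x => (hinc x _).2 (.inr rfl)
  let f : V → (ofIncidence inc).edgeSet := fun x => ⟨s(p x, q x), hpq x, x, hp x, hq x⟩
  have hmem : ∀ x r, r ∈ (f x : Sym2 P) ↔ inc x r := fun x r => by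
    rw [hinc]
    exact Sym2.mem_iff
  have hbij : Function.Bijective f := by
    constructor
    · intro x y h
      refine hinj (hpq x) (hp x) (hq x) ?_ ?_
      · rw [← hmem y, ← h, hmem]
        exact hp x
      · rw [← hmem y, ← h, hmem]
        exact hq x
    · rintro ⟨e, he⟩
      induction e with
      | _ a b =>
        obtain ⟨hab, x, ha, hb⟩ := he
        refine ⟨x, Subtype.ext ?_⟩
        exact (Sym2.mem_and_mem_iff hab).1 ⟨(hmem x a).2 ha, (hmem x b).2 hb⟩
  refine ⟨⟨Equiv.ofBijective f hbij, ?_⟩⟩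
  intro x y
  rw [lineGraph_adj_iff_exists, hG]
  simp only [Equiv.ofBijective_apply, hmem]
  exact and_congr_left' hbij.injective.ne_iff

/-! ### Linear gate systems are path-like -/

namespace GateSystem

variable {V ι : Type*} (X : GateSystem V ι)

/-- The graph on the blocks in which two blocks are adjacent if they share a vertex. -/
abbrev blockIntersection : SimpleGraph ι := ofIncidence fun x i => x ∈ X.block i

theorem connected_blockIntersection [Nonempty ι] : X.blockIntersection.Connected := by
  have hone : ∀ {i j : ι} {x : V}, x ∈ X.block i → x ∈ X.block j →
      X.blockIntersection.Reachable i j := by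
    intro i j x hi hj
    by_cases hij : i = j
    · rw [hij]
    · have hadj : X.blockIntersection.Adj i j := ⟨hij, x, hi, hj⟩
      exact hadj.reachable
  have key : ∀ {u v : V}, X.graph.Walk u v → ∀ {i j}, u ∈ X.block i → v ∈ X.block j →
      X.blockIntersection.Reachable i j := by
    intro u v p
    induction p with
    | nil => exact fun hi hj => hone hi hj
    | cons h q ih =>
      intro i j hi hj
      obtain ⟨-, m, hum, hm⟩ := h
      exact (hone hi hum).trans (ih hm hj)
  obtain ⟨r⟩ := X.connected.nonempty
  refine ⟨fun i j => ?_⟩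
  obtain ⟨p⟩ := X.connected.preconnected (X.gate i r) (X.gate j r)
  exact key p (X.gate_mem i r) (X.gate_mem j r)

/-- Some block contains at most one vertex that lies in another block. -/
theorem exists_leaf_block [Fintype V] [Finite ι] [Nonempty ι] :
    ∃ r g, ∀ x ∈ X.block r, ∀ l, l ≠ r → x ∈ X.block l → x = g := by
  classical
  -- Minimize the part beyond a block: a second vertex `x` of `block r` in another block `l` would
  -- have a strictly smaller part beyond `block l`.
  let P : ℕ → Prop := fun s => ∃ r g, g ∈ X.block r ∧ (X.beyond r g).card = s
  have hex : ∃ s, P s := by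
    obtain ⟨x⟩ := X.connected.nonempty
    exact ⟨_, Classical.arbitrary ι, _, X.gate_mem _ x, rfl⟩
  obtain ⟨r, g, hg, hcard⟩ := Nat.find_spec hex
  refine ⟨r, g, fun x hx l hl hxl => ?_⟩
  by_contra hxg
  refine Nat.find_min hex (m := (X.beyond l x).card) ?_ ⟨l, x, hxl, rfl⟩
  rw [← hcard]
  refine Finset.card_lt_card ((Finset.ssubset_iff_of_subset fun w hw => ?_).2 ⟨x, ?_, ?_⟩)
  · rw [mem_beyond] at hw ⊢
    rwa [X.gate_eq_self_of_gate_ne hl.symm hx hxl hw]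
  · rwa [mem_beyond, X.gate_of_mem hx]
  · simp [X.gate_of_mem hxl]

/-- Every vertex lies in at most two blocks and every block meets other blocks in at most two
vertices. -/
structure IsLinear : Prop where
  mem_block : ∀ {x i j l}, x ∈ X.block i → x ∈ X.block j → x ∈ X.block l → i = j ∨ i = l ∨ j = l
  cut : ∀ {i x y z j l m}, x ∈ X.block i → y ∈ X.block i → z ∈ X.block i → i ≠ j →
    x ∈ X.block j → i ≠ l → y ∈ X.block l → i ≠ m → z ∈ X.block m → x = y ∨ x = z ∨ y = z

variable {X}

/-- A block has at most one neighbour at each of its at most two cut vertices, and a leaf block has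
at most one neighbour in all. -/
theorem IsLinear.nonempty_iso_pathGraph [Fintype V] [Fintype ι] [Nonempty ι] (h : X.IsLinear) :
    Nonempty (X.blockIntersection ≃g pathGraph (Fintype.card ι)) := by
  obtain ⟨r, g, hr⟩ := X.exists_leaf_block
  refine X.connected_blockIntersection.nonempty_iso_pathGraph (r := r) ?_ ?_
  · rintro i j l m ⟨hij, x, hxi, hxj⟩ ⟨hil, y, hyi, hyl⟩ ⟨him, z, hzi, hzm⟩
    rcases h.cut hxi hyi hzi hij hxj hil hyl him hzm with rfl | rfl | rfl
    · rcases h.mem_block hxi hxj hyl with h | h | h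
      · exact absurd h hij
      · exact absurd h hil
      · exact .inl h
    · rcases h.mem_block hxi hxj hzm with h | h | h
      · exact absurd h hij
      · exact absurd h him
      · exact .inr (.inl h)
    · rcases h.mem_block hyi hyl hzm with h | h | h
      · exact absurd h hil
      · exact absurd h him
      · exact .inr (.inr h)
  · rintro i j ⟨hri, x, hxr, hxi⟩ ⟨hrj, y, hyr, hyj⟩
    obtain rfl := hr x hxr i hri.symm hxi
    obtain rfl := hr y hyr j hrj.symm hyj
    rcases h.mem_block hxr hxi hyj with h | h | h
    · exact absurd h hri
    · exact absurd h hrj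
    · exact h

variable (X) in
/-- Incidence between the vertices of `X`, as edges, and the blocks of `X` together with an
additional end for every vertex that lies in one block only. -/
def inc (x : V) : ι ⊕ {x : V // ∃! i, x ∈ X.block i} → Prop
  | .inl i => x ∈ X.block i
  | .inr y => y.1 = x

theorem IsLinear.exists_ends [Fintype V] [Nonempty ι] (h : X.IsLinear)
    (h2 : ∀ i, 2 ≤ (X.block i).card) (x : V) :
    ∃ p q, p ≠ q ∧ ∀ r, X.inc x r ↔ r = p ∨ r = q := by
  by_cases hx : ∃! i, x ∈ X.block i
  · obtain ⟨i, hi, huniq⟩ := hx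
    refine ⟨.inl i, .inr ⟨x, i, hi, huniq⟩, by simp, ?_⟩
    rintro (j | y)
    · simp only [inc, Sum.inl.injEq, reduceCtorEq, or_false]
      exact ⟨fun hj => huniq j hj, fun hj => hj ▸ hi⟩
    · simp only [inc, Sum.inr.injEq, reduceCtorEq, false_or]
      exact ⟨fun hy => Subtype.ext hy, fun hy => congrArg Subtype.val hy⟩
  · obtain ⟨i, hi⟩ := X.exists_mem_block h2 x
    obtain ⟨j, hj, hij⟩ : ∃ j, x ∈ X.block j ∧ i ≠ j := by
      by_contra hcon
      push Not at hcon
      exact hx ⟨i, hi, fun j hj => (hcon j hj).symm⟩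
    refine ⟨.inl i, .inl j, by simpa using hij, ?_⟩
    rintro (l | y)
    · simp only [inc, Sum.inl.injEq]
      constructor
      · intro hl
        rcases h.mem_block hi hj hl with h | h | h
        · exact absurd h hij
        · exact .inl h.symm
        · exact .inr h.symm
      · rintro (rfl | rfl)
        · exact hi
        · exact hj
    · simp only [inc, reduceCtorEq, or_self, iff_false]
      intro hy
      exact hx (hy ▸ y.2)

theorem inc_injective {p q : ι ⊕ {x : V // ∃! i, x ∈ X.block i}} (hpq : p ≠ q) {x y : V}
    (hxp : X.inc x p) (hxq : X.inc x q) (hyp : X.inc y p) (hyq : X.inc y q) : x = y := by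
  rcases p with i | z
  · rcases q with j | z
    · exact X.eq_of_mem_of_mem (fun h => hpq (congrArg Sum.inl h)) hxp hyp hxq hyq
    · exact hxq.symm.trans hyq
  · exact hxp.symm.trans hyp

/-- This is the edge count of a tree. Every vertex has two ends, so block orders and pendant ends
add up to 2n, while the block orders alone add up to n - 1 plus the number of blocks. -/
theorem IsLinear.card_add_card [Fintype V] [Fintype ι] [Nonempty ι] (h : X.IsLinear)
    (h2 : ∀ i, 2 ≤ (X.block i).card) :
    Nat.card V + 1 = Nat.card (ι ⊕ {x : V // ∃! i, x ∈ X.block i}) := by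
  classical
  have hx : ∀ x, (Finset.univ.filter fun i => x ∈ X.block i).card +
      (if ∃! i, x ∈ X.block i then 1 else 0) = 2 := by
    intro x
    by_cases hx : ∃! i, x ∈ X.block i
    · rw [if_pos hx]
      obtain ⟨i, hi, huniq⟩ := hx
      rw [Finset.card_eq_one.2 ⟨i, Finset.eq_singleton_iff_unique_mem.2 ⟨by simpa using hi,
        fun j hj => huniq j (by simpa using hj)⟩⟩]
    · rw [if_neg hx, add_zero, Finset.card_eq_two]
      obtain ⟨i, hi⟩ := X.exists_mem_block h2 x
      obtain ⟨j, hj, hij⟩ : ∃ j, x ∈ X.block j ∧ i ≠ j := by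
        by_contra hcon
        push Not at hcon
        exact hx ⟨i, hi, fun j hj => (hcon j hj).symm⟩
      refine ⟨i, j, hij, ?_⟩
      ext l
      simp only [Finset.mem_filter, Finset.mem_univ, true_and, Finset.mem_insert,
        Finset.mem_singleton]
      constructor
      · intro hl
        rcases h.mem_block hi hj hl with h | h | h
        · exact absurd h hij
        · exact .inl h.symm
        · exact .inr h.symm
      · rintro (rfl | rfl)
        · exact hi
        · exact hj
  have hsum : ∑ i, (X.block i).card + Fintype.card {x : V // ∃! i, x ∈ X.block i} =
      2 * Fintype.card V := by
    have h1 : ∑ i, (X.block i).card = ∑ x, (Finset.univ.filter fun i => x ∈ X.block i).card := by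
      have := Finset.sum_card_bipartiteAbove_eq_sum_card_bipartiteBelow
        (s := (Finset.univ : Finset ι)) (t := (Finset.univ : Finset V))
        (fun i x => x ∈ X.block i)
      simpa [Finset.bipartiteAbove, Finset.bipartiteBelow] using this
    rw [h1, Fintype.card_subtype, Finset.card_filter, ← Finset.sum_add_distrib,
      Finset.sum_congr rfl fun x _ => hx x]
    simp [mul_comm]
  have h3 : ∑ i, (X.block i).card = ∑ i, ((X.block i).card - 1) + Fintype.card ι := by
    have : Fintype.card ι = ∑ i : ι, 1 := by simp
    rw [this, ← Finset.sum_add_distrib]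
    exact Finset.sum_congr rfl fun i _ => (Nat.sub_add_cancel (by have := h2 i; omega)).symm
  have h4 := X.card_eq
  rw [Nat.card_eq_fintype_card, Nat.card_eq_fintype_card, Fintype.card_sum]
  omega

theorem IsLinear.nonempty_iso_lineGraph [Fintype V] [Nonempty ι] (h : X.IsLinear)
    (h2 : ∀ i, 2 ≤ (X.block i).card) :
    Nonempty (X.graph ≃g (ofIncidence X.inc).lineGraph) := by
  refine nonempty_iso_lineGraph_ofIncidence (h.exists_ends h2)
    (fun hpq => inc_injective hpq) ?_
  intro x y
  refine and_congr_right fun hxy => ?_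
  constructor
  · rintro ⟨i, hx, hy⟩
    exact ⟨.inl i, hx, hy⟩
  · rintro ⟨i | z, hx, hy⟩
    · exact ⟨i, hx, hy⟩
    · exact absurd (hx.symm.trans hy) hxy

theorem IsLinear.isTree_ofIncidence [Fintype V] [Fintype ι] [Nonempty ι] (h : X.IsLinear)
    (h2 : ∀ i, 2 ≤ (X.block i).card) : (ofIncidence X.inc).IsTree := by
  rw [isTree_iff_connected_and_card]
  constructor
  · let f : X.blockIntersection →g ofIncidence X.inc :=
      ⟨Sum.inl, fun {i j} ⟨hij, x, hi, hj⟩ => ⟨by simpa using hij, x, hi, hj⟩⟩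
    have key : ∀ p, ∃ i : ι, (ofIncidence X.inc).Reachable p (.inl i) := by
      rintro (i | ⟨y, i, hi, huniq⟩)
      · exact ⟨i, Reachable.refl _⟩
      · have hadj : (ofIncidence X.inc).Adj (.inr ⟨y, i, hi, huniq⟩) (.inl i) :=
          ⟨by simp, y, rfl, hi⟩
        exact ⟨i, hadj.reachable⟩
    refine ⟨fun p q => ?_⟩
    obtain ⟨i, hi⟩ := key p
    obtain ⟨j, hj⟩ := key q
    exact hi.trans (((X.connected_blockIntersection.preconnected i j).map f).trans hj.symm)
  · obtain ⟨e⟩ := h.nonempty_iso_lineGraph h2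
    rw [← Nat.card_congr e.toEquiv, h.card_add_card h2]

/-- The leaves are exactly the pendant ends: if a block had only one neighbour, its two or more
vertices would be parallel edges. -/
theorem IsLinear.existsUnique_adj_iff [Fintype V] [Nonempty ι] (h : X.IsLinear)
    (h2 : ∀ i, 2 ≤ (X.block i).card) (p : ι ⊕ {x : V // ∃! i, x ∈ X.block i}) :
    (¬ ∃! q, (ofIncidence X.inc).Adj p q) ↔ ∃ i, Sum.inl i = p := by
  rcases p with i | ⟨y, i, hi, huniq⟩
  · refine iff_of_true ?_ ⟨i, rfl⟩
    rintro ⟨q, hq, huq⟩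
    have hother : ∀ x ∈ X.block i, X.inc x q := by
      intro x hx
      obtain ⟨a, b, hab, hinc⟩ := h.exists_ends h2 x
      have ha : X.inc x a := (hinc a).2 (.inl rfl)
      have hb : X.inc x b := (hinc b).2 (.inr rfl)
      rcases (hinc (.inl i)).1 hx with hi | hi
      · rwa [← huq b ⟨by rw [hi]; exact hab, x, hx, hb⟩]
      · rwa [← huq a ⟨by rw [hi]; exact hab.symm, x, hx, ha⟩]
    obtain ⟨u, hu, v, hv, huv⟩ := Finset.one_lt_card.1 (h2 i)
    exact huv (inc_injective hq.1 hu (hother u hu) hv (hother v hv))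
  · refine iff_of_false (not_not.2 ⟨.inl i, ⟨by simp, y, rfl, hi⟩, ?_⟩) (by simp)
    rintro q ⟨hne, x, hx, hxq⟩
    obtain rfl : y = x := hx
    rcases q with j | z
    · rw [huniq j hxq]
    · exact absurd (congrArg Sum.inr (Subtype.ext hxq.symm)) hne

theorem IsLinear.isCaterpillar [Fintype V] [Fintype ι] [Nonempty ι] (h : X.IsLinear)
    (h2 : ∀ i, 2 ≤ (X.block i).card) : (ofIncidence X.inc).IsCaterpillar := by
  obtain ⟨g⟩ := h.nonempty_iso_pathGraph
  let f : ι → {p | ¬ ∃! q, (ofIncidence X.inc).Adj p q} := fun i =>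
    ⟨.inl i, (h.existsUnique_adj_iff h2 _).2 ⟨i, rfl⟩⟩
  have hf : Function.Bijective f := by
    constructor
    · intro i j hij
      exact Sum.inl_injective (congrArg Subtype.val hij)
    · rintro ⟨p, hp⟩
      obtain ⟨i, rfl⟩ := (h.existsUnique_adj_iff h2 _).1 hp
      exact ⟨i, rfl⟩
  let e : X.blockIntersection ≃g
      (ofIncidence X.inc).induce {p | ¬ ∃! q, (ofIncidence X.inc).Adj p q} :=
    { toEquiv := Equiv.ofBijective f hf
      map_rel_iff' := and_congr_left' Sum.inl_injective.ne_iff }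
  exact ⟨h.isTree_ofIncidence h2, _, ⟨e.symm.trans g⟩⟩

theorem IsLinear.isPathLike [Fintype V] [Fintype ι] [Nonempty ι] (h : X.IsLinear)
    (h2 : ∀ i, 2 ≤ (X.block i).card) : X.graph.IsPathLike := by
  obtain ⟨f⟩ := h.nonempty_iso_lineGraph h2
  exact .of_iso_lineGraph (h.isCaterpillar h2) f

theorem isLinear_of_not_exists_isImprovedBy [Fintype V] [Fintype ι]
    (h2 : ∀ i, 2 ≤ (X.block i).card) (hX : ¬ ∃ Y, X.IsImprovedBy Y) : X.IsLinear where
  mem_block := by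
    intro x i j l hi hj hl
    by_contra hcon
    push Not at hcon
    exact hX (X.exists_isImprovedBy_of_mem_three h2 hcon.1 hcon.2.1 hcon.2.2 hi hj hl)
  cut := by
    intro i x y z j l m hx hy hz hij hxj hil hyl him hzm
    by_contra hcon
    push Not at hcon
    exact hX (X.exists_isImprovedBy_of_three_cut h2 hcon.2.1 hcon.2.2 hcon.1 hx hy hz hij hxj
      hil hyl him hzm)

end GateSystem
end SimpleGraph

/-! ### Existence of extremal graphs and the theorem -/

namespace SimpleGraph

theorem InBlockClass.card_eq {V : Type*} [Fintype V] {t : ℕ} {b : Fin t → ℕ} {G : SimpleGraph V}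
    (hG : G.InBlockClass b) : Fintype.card V = 1 + ∑ i, (b i - 1) := by
  obtain ⟨X, -, hX⟩ := hG.exists_gateSystem
  rw [X.card_eq, add_comm]
  simp only [hX]

theorem exists_inBlockClass_isStarLike {t : ℕ} {b : Fin t → ℕ} (ht : 1 ≤ t) (hb : Antitone b)
    (hb2 : ∀ i, 2 ≤ b i) {n : ℕ} (hn : n = 1 + ∑ i, (b i - 1)) :
    ∃ G : SimpleGraph (Fin n), G.InBlockClass b ∧ G.IsStarLike := by
  have hcard : Fintype.card (Option (Σ i, Fin (b i - 1))) = n := by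
    simp [hn, add_comm]
  let e := Fintype.equivFinOfCardEq hcard
  have hclass := ((GateSystem.star b).transport e).inBlockClass ht hb hb2 fun i => by
    rw [GateSystem.card_block_transport, GateSystem.card_block_star b hb2]
  refine ⟨_, hclass, hclass.isBlockGraph, e none, fun w hw => ?_⟩
  obtain ⟨v, rfl⟩ := e.surjective w
  obtain ⟨hne, i, hu, hv⟩ := GateSystem.isUniversal_star b
    (show none ≠ v from fun h => hw (congrArg e h))
  exact ⟨hw, i, Finset.mem_map_of_mem _ hu, Finset.mem_map_of_mem _ hv⟩

theorem exists_isPathLike_steinerWiener_max {t : ℕ} {b : Fin t → ℕ} (ht : 1 ≤ t)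
    (hb : Antitone b) (hb2 : ∀ i, 2 ≤ b i) {n : ℕ} (hn : n = 1 + ∑ i, (b i - 1)) {k : ℕ}
    (hk : 1 ≤ k) :
    ∃ G : SimpleGraph (Fin n), G.InBlockClass b ∧ G.IsPathLike ∧
      ∀ G' : SimpleGraph (Fin n), G'.InBlockClass b →
        G'.steinerWiener k ≤ G.steinerWiener k := by
  have : Nonempty (Fin t) := ⟨⟨0, ht⟩⟩
  obtain ⟨G₀, hG₀, -⟩ := exists_inBlockClass_isStarLike ht hb hb2 hn
  -- `SW_2` breaks ties: an improvement need not raise `SW_k`, but it always raises `SW_2`.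
  obtain ⟨G, hG, hmax⟩ := Set.exists_max_image {G : SimpleGraph (Fin n) | G.InBlockClass b}
    (fun G => toLex (G.steinerWiener k, G.steinerWiener 2)) (Set.toFinite _) ⟨G₀, hG₀⟩
  refine ⟨G, hG, ?_, fun G' hG' => ?_⟩
  · obtain ⟨X, rfl, hX⟩ := InBlockClass.exists_gateSystem hG
    have h2 : ∀ i, 2 ≤ (X.block i).card := fun i => (hb2 i).trans_eq (hX i).symm
    refine (GateSystem.isLinear_of_not_exists_isImprovedBy h2 ?_).isPathLike h2
    rintro ⟨Y, hcard, hle, hlt⟩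
    have hY := hmax Y.graph (Y.inBlockClass ht hb hb2 fun i => (hcard i).trans (hX i))
    rw [Prod.Lex.toLex_le_toLex] at hY
    have := hle k hk
    simp only at hY
    omega
  · have h := hmax G' hG'
    rw [Prod.Lex.toLex_le_toLex] at h
    simp only at h
    omega

end SimpleGraph

theorem mainTheorem5 {t : ℕ} (b : Fin t → ℕ) (ht : 1 ≤ t) (hb : Antitone b)
    (hb2 : ∀ i, 2 ≤ b i) (n : ℕ) (hn : n = 1 + ∑ i, (b i - 1))
    (k : ℕ) (hk : 2 ≤ k) (hkn : k ≤ n) :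
    (∀ (V : Type u) [Fintype V] (G : SimpleGraph V), G.InBlockClass b →
      Fintype.card V = n ∧
      ((n : ℤ) - 1) * ((n - 1).choose (k - 1) : ℤ) - ∑ i, ((b i - 1).choose k : ℤ)
        ≤ (G.steinerWiener k : ℤ) ∧
      (G.IsStarLike → (G.steinerWiener k : ℤ) =
        ((n : ℤ) - 1) * ((n - 1).choose (k - 1) : ℤ) - ∑ i, ((b i - 1).choose k : ℤ))) ∧
    (∃ G₀ : SimpleGraph (Fin n), G₀.InBlockClass b ∧ G₀.IsStarLike) ∧
    (∃ G₁ : SimpleGraph (Fin n), G₁.InBlockClass b ∧ G₁.IsPathLike ∧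
      ∀ (V : Type u) [Fintype V] (G : SimpleGraph V), G.InBlockClass b →
        G.steinerWiener k ≤ G₁.steinerWiener k) := by
  have hk1 : 1 ≤ k := by omega
  refine ⟨?_, SimpleGraph.exists_inBlockClass_isStarLike ht hb hb2 hn, ?_⟩
  · intro V _ G hG
    have hcard : Fintype.card V = n := hG.card_eq.trans hn.symm
    obtain ⟨X, rfl, hX⟩ := hG.exists_gateSystem
    refine ⟨hcard, ?_, ?_⟩
    · have h := X.le_steinerWiener hk1
      rwa [hcard, Finset.sum_congr rfl fun i _ => by rw [hX i]] at h
    · rintro ⟨-, v, hv⟩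
      have h := X.steinerWiener_eq_of_isUniversal hk1
        (fun i => (hb2 i).trans_eq (hX i).symm) hv
      rwa [hcard, Finset.sum_congr rfl fun i _ => by rw [hX i]] at h
  · obtain ⟨G₁, hG₁, hpath, hmax⟩ :=
      SimpleGraph.exists_isPathLike_steinerWiener_max ht hb hb2 hn hk1
    refine ⟨G₁, hG₁, hpath, fun V _ G hG => ?_⟩
    have hcard : Fintype.card V = n := hG.card_eq.trans hn.symm
    obtain ⟨X, rfl, hX⟩ := hG.exists_gateSystem
    -- The maximum was taken over graphs on `Fin n`; `G` is compared through a relabelled copy.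
    rw [← X.steinerWiener_transport (Fintype.equivFinOfCardEq hcard) hk1]
    exact hmax _ ((X.transport _).inBlockClass ht hb hb2 fun i =>
      (X.card_block_transport _ i).trans (hX i))
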